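/- Let $R$ be the ring of algebraic integers in a number field $K$, and put $R^\times=R\setminus\{0\}$. Let $\mathfrak T[R]$ be the universal unital $C^*$-algebra generated by elements $u^x$ ($x\in R$), $s_a$ ($a\in R^\times$) and $e_I$ ($I$ a non-zero ideal of $R$) subject to the following relations, for all $x,y\in R$, $a,b\in R^\times$ and all non-zero ideals $I,J$ of $R$: * the $u^x$ are unitary with $u^xu^y=u^{x+y}$, the $s_a$ are isometries with $s_as_b=s_{ab}$, and $s_au^x=u^{ax}s_a$; * the $e_I$ are projections (self-adjoint idempotents) with $e_{I\cap J}=e_Ie_J$ and $e_R=1$; * $s_ae_Is_a^*=e_{aI}$; * $u^xe_I=e_Iu^x$ if $x\in I$, and $e_Iu^xe_I=0$ if $x\notin I$. Let $H_R=\bigoplus_I\ell^2(R/I)$ be the Hilbert space direct sum over all non-zero ideals $I$ of $R$, and let $\mu:\mathfrak T[R]\to\mathcal L(H_R)$ be the unital $*$-homomorphism for which * $\mu(u^x)$ acts on each summand $\ell^2(R/I)$ by translation by $x$; * $\mu(s_a)$ acts on each summand $\ell^2(R/I)$ through $\ell^2(R/I)\cong\ell^2(aR/aI)\hookrightarrow\ell^2(R/aI)$,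 where the first map is induced by multiplication by $a$; * $\mu(e_J)$ is the orthogonal projection onto the subspace $\bigoplus_{I\subseteq J}\ell^2(J/I)$. (These operators satisfy the relations above, so $\mu$ exists and is unique.) Then $\mu$ is faithful, that is, injective. Consequently $\mu$ is isometric, its image is closed in $\mathcal L(H_R)$, and $\mu$ is a $*$-isomorphism of $\mathfrak T[R]$ onto its image. -/

import Mathlib

noncomputable section

namespace RingToeplitz

set_option linter.unusedSectionVars false

open scoped nonZeroDivisors

/-! ### The defining relations -/

/-- The nonzero ideals of `R`. -/
abbrev NonzeroIdeal (R : Type*) [CommRing R] : Type _ := {I : Ideal R // I ≠ ⊥}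

namespace NonzeroIdeal

variable {R : Type*} [CommRing R] [IsDomain R]

/-- The unit ideal `R`. -/
def unit (R : Type*) [CommRing R] [IsDomain R] : NonzeroIdeal R := ⟨⊤, top_ne_bot⟩

/-- The intersection `I ∩ J` of two nonzero ideals. -/
def inter (I J : NonzeroIdeal R) : NonzeroIdeal R :=
  ⟨I.1 ⊓ J.1, fun h => by
    have h' : I.1 * J.1 = ⊥ := le_bot_iff.mp (Ideal.mul_le_inf.trans_eq h)
    rcases Ideal.mul_eq_bot.mp h' with h1 | h1
    · exact I.2 h1
    · exact J.2 h1⟩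

/-- The ideal `aI`, for `a ≠ 0`. -/
def dilate (a : R⁰) (I : NonzeroIdeal R) : NonzeroIdeal R :=
  ⟨Ideal.span {(a : R)} * I.1, fun h => by
    rcases Ideal.mul_eq_bot.mp h with h1 | h1
    · exact nonZeroDivisors.coe_ne_zero a (Ideal.span_singleton_eq_bot.mp h1)
    · exact I.2 h1⟩

end NonzeroIdeal

/-- `Rel u s e p q` says that `p = q` is one of the defining relations of the Toeplitz algebra of
the `ax + b`-semigroup of `R`, written for elements `u x` (`x ∈ R`), `s a` (`a ∈ R`, `a ≠ 0`) and
`e I` (`I` a nonzero ideal) of a unital `*`-ring `A`. -/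
inductive Rel {R : Type*} [CommRing R] [IsDomain R] {A : Type*} [Ring A] [StarRing A]
    (u : R → A) (s : R⁰ → A) (e : NonzeroIdeal R → A) : A → A → Prop
  /-- the `u x` are unitary -/
  | u_star_mul_self (x : R) : Rel u s e (star (u x) * u x) 1
  | u_mul_star_self (x : R) : Rel u s e (u x * star (u x)) 1
  | u_mul_u (x y : R) : Rel u s e (u x * u y) (u (x + y))
  /-- the `s a` are isometries -/
  | s_star_mul_self (a : R⁰) : Rel u s e (star (s a) * s a) 1
  | s_mul_s (a b : R⁰) : Rel u s e (s a * s b) (s (a * b))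
  | s_mul_u (a : R⁰) (x : R) : Rel u s e (s a * u x) (u (a * x) * s a)
  /-- the `e I` are projections -/
  | e_star (I : NonzeroIdeal R) : Rel u s e (star (e I)) (e I)
  | e_mul_self (I : NonzeroIdeal R) : Rel u s e (e I * e I) (e I)
  | e_inter (I J : NonzeroIdeal R) : Rel u s e (e (I.inter J)) (e I * e J)
  | e_unit : Rel u s e (e (NonzeroIdeal.unit R)) 1
  | s_e_s (a : R⁰) (I : NonzeroIdeal R) : Rel u s e (s a * e I * star (s a)) (e (I.dilate a))
  | u_e_of_mem (I : NonzeroIdeal R) (x : R) (hx : x ∈ I.1) : Rel u s e (u x * e I) (e I * u x)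
  | e_u_e_of_notMem (I : NonzeroIdeal R) (x : R) (hx : x ∉ I.1) : Rel u s e (e I * u x * e I) 0

/-- The elements `u x`, `s a`, `e I` of the unital `*`-ring `A` satisfy all the defining
relations of the Toeplitz algebra. -/
def IsFamily {R : Type*} [CommRing R] [IsDomain R] {A : Type*} [Ring A] [StarRing A]
    (u : R → A) (s : R⁰ → A) (e : NonzeroIdeal R → A) : Prop :=
  ∀ p q : A, Rel u s e p q → p = q

/-! ### The free unital `*`-algebra on the generators -/

/-- The formal generators. -/
inductive Gen (R : Type*) [CommRing R] [IsDomain R]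
  | u (x : R)
  | s (a : R⁰)
  | e (I : NonzeroIdeal R)

/-- The free unital `*`-algebra over `ℂ` on the formal generators: the free algebra on symbols
`(g, false)`, standing for `g`, and `(g, true)`, standing for `g*`. -/
def Free (R : Type*) [CommRing R] [IsDomain R] : Type _ := FreeAlgebra ℂ (Gen R × Bool)

namespace Free

variable {R : Type*} [CommRing R] [IsDomain R]

instance : Ring (Free R) := inferInstanceAs (Ring (FreeAlgebra ℂ (Gen R × Bool)))
instance : Algebra ℂ (Free R) := inferInstanceAs (Algebra ℂ (FreeAlgebra ℂ (Gen R × Bool)))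

/-- The symbol `(g, b)` as an element of the free `*`-algebra. -/
def ι (g : Gen R × Bool) : Free R := FreeAlgebra.ι ℂ g

theorem induction {C : Free R → Prop} (h0 : ∀ r : ℂ, C (algebraMap ℂ (Free R) r))
    (h1 : ∀ g, C (ι g)) (hmul : ∀ a b, C a → C b → C (a * b))
    (hadd : ∀ a b, C a → C b → C (a + b)) (a : Free R) : C a :=
  FreeAlgebra.induction ℂ (Gen R × Bool) (motive := C) h0 h1 hmul hadd a

/-- The opposite ring of the free `*`-algebra, with the conjugate action of `ℂ`. -/
def ConjOp (R : Type*) [CommRing R] [IsDomain R] : Type _ := (Free R)ᵐᵒᵖ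

instance : Ring (ConjOp R) := inferInstanceAs (Ring (Free R)ᵐᵒᵖ)

instance : Algebra ℂ (ConjOp R) :=
  RingHom.toAlgebra' ((algebraMap ℂ (Free R)ᵐᵒᵖ).comp (starRingEnd ℂ))
    (fun c x => Algebra.commutes (starRingEnd ℂ c) (show (Free R)ᵐᵒᵖ from x))

/-- The involution, as a homomorphism to the opposite ring: it is conjugate linear and exchanges
`(g, false)` and `(g, true)`. -/
def starAlgHom : Free R →ₐ[ℂ] ConjOp R :=
  FreeAlgebra.lift ℂ (fun g : Gen R × Bool =>
    (show ConjOp R from MulOpposite.op (ι (g.1, !g.2))))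

/-- The involution as a ring homomorphism to the opposite ring. -/
def starHom : Free R →+* (Free R)ᵐᵒᵖ := (starAlgHom (R := R)).toRingHom

theorem starHom_ι (g : Gen R × Bool) : starHom (ι g) = MulOpposite.op (ι (g.1, !g.2)) :=
  FreeAlgebra.lift_ι_apply (R := ℂ) (A := ConjOp R) _ g

theorem starHom_algebraMap (r : ℂ) :
    starHom (algebraMap ℂ (Free R) r) =
      MulOpposite.op (algebraMap ℂ (Free R) (starRingEnd ℂ r)) :=
  (starAlgHom (R := R)).commutes r

instance : StarRing (Free R) where
  star x := (starHom x).unop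
  star_involutive x := by
    induction x using Free.induction with
    | h0 r => simp [starHom_algebraMap]
    | h1 g => simp [starHom_ι]
    | hmul a b ha hb => simp [ha, hb]
    | hadd a b ha hb => simp [ha, hb]
  star_mul a b := by simp
  star_add a b := by simp

theorem star_ι (g : Gen R × Bool) : star (ι g) = ι (g.1, !g.2) := by
  change (starHom (ι g)).unop = _
  rw [starHom_ι]; rfl

theorem star_algebraMap (r : ℂ) :
    star (algebraMap ℂ (Free R) r) = algebraMap ℂ (Free R) (star r) := by
  change (starHom _).unop = _
  rw [starHom_algebraMap]; rfl

instance : StarModule ℂ (Free R) where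
  star_smul r x := by
    rw [Algebra.smul_def, star_mul, star_algebraMap, Algebra.smul_def, Algebra.commutes]

/-- The free generator `u x`. -/
def u (x : R) : Free R := ι (Gen.u x, false)
/-- The free generator `s a`. -/
def s (a : R⁰) : Free R := ι (Gen.s a, false)
/-- The free generator `e I`. -/
def e (I : NonzeroIdeal R) : Free R := ι (Gen.e I, false)

/-! ### The largest `C*`-seminorm compatible with the relations -/

/-- `C*`-seminorms on the free `*`-algebra for which the defining relations hold, that is,
`p (y - z) = 0` for each relation `y = z`. -/
structure IsAdmissible (p : Seminorm ℂ (Free R)) : Prop where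
  mul_le : ∀ x y, p (x * y) ≤ p x * p y
  star_mul_self : ∀ x, p (star x * x) = p x ^ 2
  rel : ∀ y z, Rel u s e y z → p (y - z) = 0

namespace IsAdmissible

variable {p : Seminorm ℂ (Free R)}

theorem eq_of_rel (hp : IsAdmissible p) {y z : Free R} (h : Rel u s e y z) : p y = p z := by
  have h0 := hp.rel y z h
  have h1 := map_add_le_add p (y - z) z
  have h2 := map_add_le_add p (z - y) y
  rw [map_sub_rev] at h2
  simp only [sub_add_cancel] at h1 h2
  linarith

theorem le_star (hp : IsAdmissible p) (x : Free R) : p x ≤ p (star x) := by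
  have h := hp.mul_le (star x) x
  rw [hp.star_mul_self, sq] at h
  rcases (apply_nonneg p x).eq_or_lt with h0 | h0
  · rw [← h0]; exact apply_nonneg p _
  · exact le_of_mul_le_mul_right h h0

theorem map_star (hp : IsAdmissible p) (x : Free R) : p (star x) = p x :=
  le_antisymm (by simpa using hp.le_star (star x)) (hp.le_star x)

theorem one_le (hp : IsAdmissible p) : p 1 ≤ 1 := by
  have h := hp.star_mul_self 1
  rw [star_one, mul_one] at h
  nlinarith [apply_nonneg p 1]

theorem le_one_of_star_mul_self (hp : IsAdmissible p) {x : Free R} (h : p (star x * x) ≤ 1) : p x ≤ 1 := by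
  rw [hp.star_mul_self] at h
  nlinarith [apply_nonneg p x]

theorem gen_le (hp : IsAdmissible p) (g : Gen R) : p (ι (g, false)) ≤ 1 := by
  cases g with
  | u x =>
    apply hp.le_one_of_star_mul_self
    exact (hp.eq_of_rel (Rel.u_star_mul_self x)).trans_le hp.one_le
  | s a =>
    apply hp.le_one_of_star_mul_self
    exact (hp.eq_of_rel (Rel.s_star_mul_self a)).trans_le hp.one_le
  | e I =>
    change p (e I) ≤ 1
    have h1 := hp.star_mul_self (e I)
    have h2 : p (star (e I) * e I - e I * e I) = 0 := by
      rw [← sub_mul]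
      refine le_antisymm ((hp.mul_le _ _).trans ?_) (apply_nonneg p _)
      rw [hp.rel _ _ (Rel.e_star I), zero_mul]
    have h3 := map_add_le_add p (star (e I) * e I - e I * e I) (e I * e I)
    rw [sub_add_cancel, h2, zero_add, h1, hp.eq_of_rel (Rel.e_mul_self I)] at h3
    nlinarith [apply_nonneg p (e I)]

theorem ι_le (hp : IsAdmissible p) (g : Gen R × Bool) : p (ι g) ≤ 1 := by
  obtain ⟨g, b⟩ := g
  cases b with
  | false => exact hp.gen_le g
  | true =>
    have h := hp.map_star (ι (g, false))
    rw [star_ι] at h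
    exact h.trans_le (hp.gen_le g)

end IsAdmissible

theorem exists_bound (x : Free R) :
    ∃ C : ℝ, ∀ p : Seminorm ℂ (Free R), IsAdmissible p → p x ≤ C := by
  induction x using Free.induction with
  | h0 r =>
    refine ⟨‖r‖, fun p hp => ?_⟩
    rw [Algebra.algebraMap_eq_smul_one, map_smul_eq_mul]
    exact mul_le_of_le_one_right (norm_nonneg r) hp.one_le
  | h1 g => exact ⟨1, fun p hp => hp.ι_le g⟩
  | hmul a b ha hb =>
    obtain ⟨A, hA⟩ := ha
    obtain ⟨B, hB⟩ := hb
    refine ⟨A * B, fun p hp => (hp.mul_le a b).trans ?_⟩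
    exact mul_le_mul (hA p hp) (hB p hp) (apply_nonneg p b) ((apply_nonneg p a).trans (hA p hp))
  | hadd a b ha hb =>
    obtain ⟨A, hA⟩ := ha
    obtain ⟨B, hB⟩ := hb
    exact ⟨A + B, fun p hp => (map_add_le_add p a b).trans (add_le_add (hA p hp) (hB p hp))⟩

theorem isAdmissible_zero : IsAdmissible (0 : Seminorm ℂ (Free R)) where
  mul_le x y := by simp
  star_mul_self x := by simp
  rel y z _ := by simp

instance : Nonempty {p : Seminorm ℂ (Free R) // IsAdmissible p} := ⟨⟨0, isAdmissible_zero⟩⟩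

/-- The supremum of all `C*`-seminorms for which the defining relations hold. -/
def univNorm (x : Free R) : ℝ := ⨆ p : {p : Seminorm ℂ (Free R) // IsAdmissible p}, p.1 x

theorem le_univNorm {p : Seminorm ℂ (Free R)} (hp : IsAdmissible p) (x : Free R) :
    p x ≤ univNorm x := by
  obtain ⟨C, hC⟩ := exists_bound x
  refine le_ciSup (f := fun p : {p : Seminorm ℂ (Free R) // IsAdmissible p} => p.1 x) ?_ ⟨p, hp⟩
  exact ⟨C, by rintro _ ⟨q, rfl⟩; exact hC q.1 q.2⟩

theorem univNorm_le {x : Free R} {C : ℝ}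
    (h : ∀ p : Seminorm ℂ (Free R), IsAdmissible p → p x ≤ C) : univNorm x ≤ C :=
  ciSup_le fun p => h p.1 p.2

theorem univNorm_nonneg (x : Free R) : 0 ≤ univNorm x := by
  simpa using le_univNorm isAdmissible_zero x

/-- The supremum as a seminorm. -/
def univSeminorm : Seminorm ℂ (Free R) :=
  Seminorm.of univNorm
    (fun x y => univNorm_le fun p hp =>
      (map_add_le_add p x y).trans (add_le_add (le_univNorm hp x) (le_univNorm hp y)))
    (fun c x => by
      have key : ∀ (c : ℂ) (x : Free R), univNorm (c • x) ≤ ‖c‖ * univNorm x := fun c x =>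
        univNorm_le fun p hp => by
          rw [map_smul_eq_mul]
          exact mul_le_mul_of_nonneg_left (le_univNorm hp x) (norm_nonneg c)
      refine le_antisymm (key c x) ?_
      rcases eq_or_ne c 0 with rfl | hc
      · simpa using univNorm_nonneg (0 : Free R)
      · have h := key c⁻¹ (c • x)
        rw [inv_smul_smul₀ hc, norm_inv] at h
        have hc' : 0 < ‖c‖ := norm_pos_iff.mpr hc
        rwa [← div_eq_inv_mul, le_div_iff₀ hc', mul_comm] at h)

theorem univSeminorm_apply (x : Free R) : univSeminorm x = univNorm x := rfl

theorem isAdmissible_univSeminorm : IsAdmissible (univSeminorm (R := R)) where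
  mul_le x y := univNorm_le fun p hp => (hp.mul_le x y).trans
    (mul_le_mul (le_univNorm hp x) (le_univNorm hp y) (apply_nonneg p y) (univNorm_nonneg x))
  star_mul_self x := by
    refine le_antisymm (univNorm_le fun p hp => ?_) ?_
    · rw [hp.star_mul_self]
      exact pow_le_pow_left₀ (apply_nonneg p x) (le_univNorm hp x) 2
    · have h : univNorm x ≤ Real.sqrt (univNorm (star x * x)) := univNorm_le fun p hp =>
        Real.le_sqrt_of_sq_le ((hp.star_mul_self x).symm.trans_le (le_univNorm hp _))
      calc univNorm x ^ 2 ≤ Real.sqrt (univNorm (star x * x)) ^ 2 :=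
            pow_le_pow_left₀ (univNorm_nonneg x) h 2
        _ = univNorm (star x * x) := Real.sq_sqrt (univNorm_nonneg _)
  rel y z h := le_antisymm (univNorm_le fun p hp => (hp.rel y z h).le) (univNorm_nonneg _)

instance : SeminormedRing (Free R) where
  __ := (univSeminorm (R := R)).toAddGroupSeminorm.toSeminormedAddCommGroup
  __ := (inferInstance : Ring (Free R))
  norm_mul_le := isAdmissible_univSeminorm.mul_le

theorem norm_def (x : Free R) : ‖x‖ = univNorm x := rfl

instance : NormedAlgebra ℂ (Free R) where
  norm_smul_le c x := (map_smul_eq_mul (univSeminorm (R := R)) c x).le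

instance : NormedStarGroup (Free R) where
  norm_star_le x := (isAdmissible_univSeminorm.map_star x).le

end Free

/-! ### The Toeplitz algebra -/

open UniformSpace

/-- The Toeplitz algebra of the `ax + b`-semigroup of `R`: the universal `C*`-algebra on the
generators `u x`, `s a`, `e I` and the relations `Rel`, that is, the Hausdorff completion of the
free `*`-algebra in the largest `C*`-seminorm for which the relations hold. -/
abbrev Toeplitz (R : Type*) [CommRing R] [IsDomain R] : Type _ := Completion (Free R)

namespace Toeplitz

variable {R : Type*} [CommRing R] [IsDomain R]

instance : Star (Toeplitz R) := ⟨Completion.map star⟩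

theorem star_coe (x : Free R) : star (x : Toeplitz R) = ((star x : Free R) : Toeplitz R) :=
  Completion.map_coe (NormedAddGroupHom.uniformContinuous
    (starNormedAddGroupHom (E := Free R))) x

theorem continuous_star' : Continuous (star : Toeplitz R → Toeplitz R) :=
  Completion.continuous_map

instance : StarRing (Toeplitz R) where
  star_involutive x := by
    induction x using Completion.induction_on with
    | hp => exact isClosed_eq (continuous_star'.comp continuous_star') continuous_id
    | ih x => simp only [star_coe, star_star]
  star_mul x y := by
    induction x, y using Completion.induction_on₂ with
    | hp =>
      exact isClosed_eq (continuous_star'.comp continuous_mul)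
        ((continuous_star'.comp continuous_snd).mul (continuous_star'.comp continuous_fst))
    | ih x y => simp only [star_coe, ← Completion.coe_mul, star_mul]
  star_add x y := by
    induction x, y using Completion.induction_on₂ with
    | hp =>
      exact isClosed_eq (continuous_star'.comp continuous_add)
        ((continuous_star'.comp continuous_fst).add (continuous_star'.comp continuous_snd))
    | ih x y => simp only [star_coe, ← Completion.coe_add, star_add]

instance : CStarAlgebra (Toeplitz R) where
  norm_mul_self_le x := by
    induction x using Completion.induction_on with
    | hp =>
      exact isClosed_le (continuous_norm.mul continuous_norm)
        (continuous_norm.comp (continuous_star'.mul continuous_id))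
    | ih x =>
      rw [star_coe, ← Completion.coe_mul, Completion.norm_coe, Completion.norm_coe, ← sq]
      exact (Free.isAdmissible_univSeminorm.star_mul_self x).ge
  norm_smul_le c x := norm_smul_le c x
  star_smul c x := by
    induction x using Completion.induction_on with
    | hp =>
      exact isClosed_eq (continuous_star'.comp (continuous_const_smul c))
        (continuous_star'.const_smul (star c))
    | ih x => simp only [star_coe, ← Completion.coe_smul, star_smul]

/-- The generator `u x` of the Toeplitz algebra. -/
def u (x : R) : Toeplitz R := (Free.u x : Free R)
/-- The generator `s a` of the Toeplitz algebra. -/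
def s (a : R⁰) : Toeplitz R := (Free.s a : Free R)
/-- The generator `e I` of the Toeplitz algebra. -/
def e (I : NonzeroIdeal R) : Toeplitz R := (Free.e I : Free R)

end Toeplitz

/-! ### Homomorphisms transport the relations -/

section Map

variable {R : Type*} [CommRing R] [IsDomain R] {A B : Type*} [Ring A] [StarRing A]
  [Ring B] [StarRing B]

theorem Rel.map {u : R → A} {s : R⁰ → A} {e : NonzeroIdeal R → A} {u' : R → B} {s' : R⁰ → B}
    {e' : NonzeroIdeal R → B} (φ : A →+* B) (hφ : ∀ x, φ (star x) = star (φ x))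
    (hu : ∀ x, φ (u x) = u' x) (hs : ∀ a, φ (s a) = s' a) (he : ∀ I, φ (e I) = e' I)
    {p q : A} (h : Rel u s e p q) : Rel u' s' e' (φ p) (φ q) := by
  cases h <;> simp only [map_mul, map_one, map_zero, hφ, hu, hs, he]
  all_goals first
    | exact Rel.e_u_e_of_notMem _ _ ‹_›
    | exact Rel.u_e_of_mem _ _ ‹_›
    | constructor

end Map

namespace Toeplitz

section Lift

variable {R : Type*} [CommRing R] [IsDomain R]

/-- The generators of the Toeplitz algebra satisfy the defining relations. -/
theorem isFamily : IsFamily (u (R := R)) s e := by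
  have key : ∀ p q : Free R, Rel Free.u Free.s Free.e p q → (p : Toeplitz R) = q := by
    intro p q h
    rw [← sub_eq_zero, ← Completion.coe_sub, ← norm_eq_zero, Completion.norm_coe]
    exact Free.isAdmissible_univSeminorm.rel p q h
  have hmul (x y : Free R) : ((x * y : Free R) : Toeplitz R) = x * y := Completion.coe_mul x y
  have hst (x : Free R) : ((star x : Free R) : Toeplitz R) = star (x : Toeplitz R) :=
    (star_coe x).symm
  have hone : ((1 : Free R) : Toeplitz R) = 1 := Completion.coe_one (Free R)
  intro p q h
  cases h with
  | u_star_mul_self x => simpa [hmul, hst, hone] using! key _ _ (Rel.u_star_mul_self x)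
  | u_mul_star_self x => simpa [hmul, hst, hone] using! key _ _ (Rel.u_mul_star_self x)
  | u_mul_u x y => simpa [hmul, hst, hone] using! key _ _ (Rel.u_mul_u x y)
  | s_star_mul_self a => simpa [hmul, hst, hone] using! key _ _ (Rel.s_star_mul_self a)
  | s_mul_s a b => simpa [hmul, hst, hone] using! key _ _ (Rel.s_mul_s a b)
  | s_mul_u a x => simpa [hmul, hst, hone] using! key _ _ (Rel.s_mul_u a x)
  | e_star I => simpa [hmul, hst, hone] using! key _ _ (Rel.e_star I)
  | e_mul_self I => simpa [hmul, hst, hone] using! key _ _ (Rel.e_mul_self I)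
  | e_inter I J => simpa [hmul, hst, hone] using! key _ _ (Rel.e_inter I J)
  | e_unit => simpa [hmul, hst, hone] using! key _ _ Rel.e_unit
  | s_e_s a I => simpa [hmul, hst, hone] using! key _ _ (Rel.s_e_s a I)
  | u_e_of_mem I x hx => simpa [hmul, hst, hone] using! key _ _ (Rel.u_e_of_mem I x hx)
  | e_u_e_of_notMem I x hx => simpa [hmul, hst, hone] using! key _ _ (Rel.e_u_e_of_notMem I x hx)

variable {B : Type*} [CStarAlgebra B]

/-- The images of the symbols under the homomorphism attached to a family `u, s, e`. -/
def symbolMap (u : R → B) (s : R⁰ → B) (e : NonzeroIdeal R → B) : Gen R × Bool → B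
  | (.u x, false) => u x
  | (.s a, false) => s a
  | (.e I, false) => e I
  | (.u x, true) => star (u x)
  | (.s a, true) => star (s a)
  | (.e I, true) => star (e I)

/-- The homomorphism from the free `*`-algebra attached to a family `u, s, e`. -/
def freeLift (u : R → B) (s : R⁰ → B) (e : NonzeroIdeal R → B) : Free R →ₐ[ℂ] B :=
  FreeAlgebra.lift ℂ (symbolMap u s e)

theorem freeLift_ι (u : R → B) (s : R⁰ → B) (e : NonzeroIdeal R → B) (g : Gen R × Bool) :
    freeLift u s e (Free.ι g) = symbolMap u s e g :=
  FreeAlgebra.lift_ι_apply _ g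

theorem freeLift_star (u : R → B) (s : R⁰ → B) (e : NonzeroIdeal R → B) (x : Free R) :
    freeLift u s e (star x) = star (freeLift u s e x) := by
  induction x using Free.induction with
  | h0 r => rw [Free.star_algebraMap, AlgHom.commutes, AlgHom.commutes, algebraMap_star_comm]
  | h1 g =>
    rw [Free.star_ι, freeLift_ι, freeLift_ι]
    rcases g with ⟨_ | _ | _, _ | _⟩ <;> simp [symbolMap]
  | hmul a b ha hb => simp [ha, hb]
  | hadd a b ha hb => simp [ha, hb]

theorem norm_freeLift_le {u : R → B} {s : R⁰ → B} {e : NonzeroIdeal R → B}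
    (h : IsFamily u s e) (x : Free R) : ‖freeLift u s e x‖ ≤ ‖x‖ := by
  let p : Seminorm ℂ (Free R) := (normSeminorm ℂ B).comp (freeLift u s e).toLinearMap
  have hpx (x : Free R) : p x = ‖freeLift u s e x‖ := rfl
  have hp : Free.IsAdmissible p :=
    { mul_le := fun x y => by simpa only [hpx, map_mul] using norm_mul_le _ _
      star_mul_self := fun x => by
        simp only [hpx, map_mul, freeLift_star, CStarRing.norm_star_mul_self, sq]
      rel := fun y z hyz => by
        rw [hpx, map_sub, norm_eq_zero, sub_eq_zero]
        exact h _ _ (Rel.map (freeLift u s e).toRingHom (freeLift_star u s e)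
          (fun x => freeLift_ι u s e _) (fun a => freeLift_ι u s e _)
          (fun I => freeLift_ι u s e _) hyz) }
  exact Free.le_univNorm hp x

theorem continuous_freeLift {u : R → B} {s : R⁰ → B} {e : NonzeroIdeal R → B}
    (h : IsFamily u s e) : Continuous (freeLift u s e) :=
  AddMonoidHomClass.continuous_of_bound (freeLift u s e) 1
    (fun x => by simpa using norm_freeLift_le h x)

/-- The universal property: a family `u, s, e` in a `C*`-algebra `B` that satisfies the defining
relations induces a unital `*`-homomorphism from the Toeplitz algebra to `B`. -/
def lift (u : R → B) (s : R⁰ → B) (e : NonzeroIdeal R → B) (h : IsFamily u s e) :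
    Toeplitz R →⋆ₐ[ℂ] B where
  __ := Completion.extensionHom (freeLift u s e).toRingHom (continuous_freeLift h)
  commutes' r := (Completion.extensionHom_coe (freeLift u s e).toRingHom
    (continuous_freeLift h) (algebraMap ℂ (Free R) r)).trans ((freeLift u s e).commutes r)
  map_star' x := by
    change Completion.extension (freeLift u s e) (star x)
      = star (Completion.extension (freeLift u s e) x)
    have hc : Continuous (Completion.extension (freeLift u s e)) := Completion.continuous_extension
    have hco (y : Free R) : Completion.extension (freeLift u s e) (y : Toeplitz R) =
        freeLift u s e y :=
      Completion.extensionHom_coe (freeLift u s e).toRingHom (continuous_freeLift h) y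
    induction x using Completion.induction_on with
    | hp => exact isClosed_eq (hc.comp continuous_star') hc.star
    | ih x => rw [star_coe, hco, hco, freeLift_star]

variable {u' : R → B} {s' : R⁰ → B} {e' : NonzeroIdeal R → B} (h : IsFamily u' s' e')

theorem lift_coe (x : Free R) : lift u' s' e' h x = freeLift u' s' e' x :=
  Completion.extensionHom_coe (freeLift u' s' e').toRingHom (continuous_freeLift h) x

theorem lift_u (x : R) : lift u' s' e' h (u x) = u' x :=
  (lift_coe h _).trans (freeLift_ι u' s' e' _)

theorem lift_s (a : R⁰) : lift u' s' e' h (s a) = s' a :=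
  (lift_coe h _).trans (freeLift_ι u' s' e' _)

theorem lift_e (I : NonzeroIdeal R) : lift u' s' e' h (e I) = e' I :=
  (lift_coe h _).trans (freeLift_ι u' s' e' _)

theorem continuous_hom (φ : Toeplitz R →⋆ₐ[ℂ] B) : Continuous φ :=
  AddMonoidHomClass.continuous_of_bound φ 1
    (fun x => by simpa using NonUnitalStarAlgHom.norm_apply_le φ x)

/-- Uniqueness in the universal property. -/
theorem hom_ext {φ ψ : Toeplitz R →⋆ₐ[ℂ] B} (hu : ∀ x, φ (u x) = ψ (u x))
    (hs : ∀ a, φ (s a) = ψ (s a)) (he : ∀ I, φ (e I) = ψ (e I)) : φ = ψ := by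
  have hstar (g : Gen R) : ((Free.ι (g, true) : Free R) : Toeplitz R) =
      star ((Free.ι (g, false) : Free R) : Toeplitz R) := by
    rw [star_coe, Free.star_ι]; rfl
  have hgen (g : Gen R) : φ (Free.ι (g, false) : Free R) = ψ (Free.ι (g, false) : Free R) := by
    cases g with
    | u x => exact hu x
    | s a => exact hs a
    | e I => exact he I
  ext x
  induction x using Completion.induction_on with
  | hp => exact isClosed_eq (continuous_hom φ) (continuous_hom ψ)
  | ih x =>
    induction x using Free.induction with
    | h0 r => exact (AlgHomClass.commutes φ r).trans (AlgHomClass.commutes ψ r).symm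
    | h1 g =>
      rcases g with ⟨g, _ | _⟩
      · exact hgen g
      · rw [hstar, map_star, map_star, hgen]
    | hmul a b ha hb => rw [Completion.coe_mul, map_mul, map_mul, ha, hb]
    | hadd a b ha hb => rw [Completion.coe_add, map_add, map_add, ha, hb]

end Lift

end Toeplitz

/-! ### The natural representation on `⨁ I, ℓ²(R/I)` -/

section Operators

/-- `ℓ²(X)`. -/
abbrev L2 (X : Type*) : Type _ := lp (fun _ : X => ℂ) 2

open Classical in
/-- The inclusion of the `i`-th summand in a Hilbert space direct sum. -/
def summand {ι : Type*} {G : ι → Type*} [∀ i, NormedAddCommGroup (G i)]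
    [∀ i, InnerProductSpace ℂ (G i)] (i : ι) : G i →ₗᵢ[ℂ] lp G 2 where
  __ := lp.lsingle (𝕜 := ℂ) (E := G) 2 i
  norm_map' a := lp.norm_single (E := G) (by norm_num) i a

theorem summand_eq_single {ι : Type*} [DecidableEq ι] {G : ι → Type*}
    [∀ i, NormedAddCommGroup (G i)] [∀ i, InnerProductSpace ℂ (G i)] (i : ι) (v : G i) :
    summand (G := G) i v = lp.single 2 i v := by
  obtain rfl : ‹DecidableEq ι› = fun a b => Classical.propDecidable (a = b) :=
    Subsingleton.elim _ _
  rfl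

theorem orthogonalFamily_summand {ι : Type*} (G : ι → Type*) [∀ i, NormedAddCommGroup (G i)]
    [∀ i, InnerProductSpace ℂ (G i)] :
    OrthogonalFamily ℂ G (fun i => summand (G := G) i) := by
  classical
  intro i j h v w
  rw [summand_eq_single, lp.inner_single_left, summand_eq_single,
    lp.single_apply_ne (E := G) 2 j w h, inner_zero_right]

/-- The standard orthonormal basis vector of `ℓ²(X)` at `x`. -/
def delta {X : Type*} (x : X) : L2 X := summand (G := fun _ : X => ℂ) x 1

theorem orthonormal_delta (X : Type*) : Orthonormal ℂ (delta (X := X)) := by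
  refine ⟨fun x => ?_, fun x y h => orthogonalFamily_summand (fun _ : X => ℂ) h 1 1⟩
  rw [delta, LinearIsometry.norm_map, norm_one]

/-- The isometry `ℓ²(X) → ℓ²(Y)`, `delta x ↦ delta (f x)`, induced by an injective map `f`. -/
def pushforward {X Y : Type*} (f : X → Y) (hf : Function.Injective f) : L2 X →ₗᵢ[ℂ] L2 Y :=
  ((orthonormal_delta Y).comp f hf).orthogonalFamily.linearIsometry

theorem pushforward_delta {X Y : Type*} (f : X → Y) (hf : Function.Injective f) (x : X) :
    pushforward f hf (delta x) = delta (f x) := by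
  classical
  have h := ((orthonormal_delta Y).comp f hf).orthogonalFamily.linearIsometry_apply_single
    (i := x) (1 : ℂ)
  rw [LinearIsometry.toSpanSingleton_apply, one_smul] at h
  rw [delta, summand_eq_single]
  exact h

end Operators

section Representation

variable (R : Type*) [CommRing R] [IsDomain R]

/-- The Hilbert space `⨁ I, ℓ²(R/I)`, the sum over all nonzero ideals `I` of `R`. -/
abbrev HilbertSum : Type _ := lp (fun I : NonzeroIdeal R => L2 (R ⧸ I.1)) 2

variable {R}

/-- The standard orthonormal basis vector of `⨁ I, ℓ²(R/I)` at the class `y ∈ R/I`. -/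
def basisVector (I : NonzeroIdeal R) (y : R ⧸ I.1) : HilbertSum R :=
  summand (G := fun I : NonzeroIdeal R => L2 (R ⧸ I.1)) I (delta y)

theorem orthonormal_basisVector : Orthonormal ℂ
    (fun p : Σ I : NonzeroIdeal R, R ⧸ I.1 => basisVector p.1 p.2) := by
  refine ⟨fun p => ?_, ?_⟩
  · exact (LinearIsometry.norm_map _ _).trans ((orthonormal_delta _).1 _)
  · rintro ⟨I, y⟩ ⟨J, z⟩ h
    by_cases hIJ : I = J
    · subst hIJ
      have hyz : y ≠ z := fun h' => h (h' ▸ rfl)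
      exact (LinearIsometry.inner_map_map _ _ _).trans ((orthonormal_delta _).2 hyz)
    · exact orthogonalFamily_summand (fun I : NonzeroIdeal R => L2 (R ⧸ I.1)) hIJ _ _

theorem orthogonalFamily_block (φ : NonzeroIdeal R → NonzeroIdeal R) (hφ : Function.Injective φ)
    (f : ∀ I : NonzeroIdeal R, R ⧸ I.1 → R ⧸ (φ I).1) (hf : ∀ I, Function.Injective (f I)) :
    OrthogonalFamily ℂ (fun I : NonzeroIdeal R => L2 (R ⧸ I.1))
      (fun I => (summand (G := fun I : NonzeroIdeal R => L2 (R ⧸ I.1)) (φ I)).comp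
        (pushforward (f I) (hf I))) :=
  fun _ _ h _ _ => orthogonalFamily_summand (fun I : NonzeroIdeal R => L2 (R ⧸ I.1))
    (fun h' => h (hφ h')) _ _

/-- The isometry of `⨁ I, ℓ²(R/I)` that embeds each summand `ℓ²(R/I)` in the summand
`ℓ²(R/φ(I))` by means of an injective map `f I : R/I → R/φ(I)`, where `φ` is injective. -/
def blockIsometry (φ : NonzeroIdeal R → NonzeroIdeal R) (hφ : Function.Injective φ)
    (f : ∀ I : NonzeroIdeal R, R ⧸ I.1 → R ⧸ (φ I).1) (hf : ∀ I, Function.Injective (f I)) :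
    HilbertSum R →ₗᵢ[ℂ] HilbertSum R :=
  (orthogonalFamily_block φ hφ f hf).linearIsometry

theorem blockIsometry_basisVector (φ : NonzeroIdeal R → NonzeroIdeal R)
    (hφ : Function.Injective φ) (f : ∀ I : NonzeroIdeal R, R ⧸ I.1 → R ⧸ (φ I).1)
    (hf : ∀ I, Function.Injective (f I)) (I : NonzeroIdeal R) (y : R ⧸ I.1) :
    blockIsometry φ hφ f hf (basisVector I y) = basisVector (φ I) (f I y) := by
  classical
  have h := (orthogonalFamily_block φ hφ f hf).linearIsometry_apply_single (i := I) (delta y)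
  rw [basisVector, summand_eq_single, basisVector, ← pushforward_delta (f I) (hf I)]
  exact h

/-- Bounded operators that agree on all the basis vectors are equal. -/
theorem operator_ext {S T : HilbertSum R →L[ℂ] HilbertSum R}
    (h : ∀ I y, S (basisVector I y) = T (basisVector I y)) : S = T := by
  classical
  refine lp.ext_continuousLinearMap (by norm_num) fun I => ?_
  refine lp.ext_continuousLinearMap (by norm_num) fun y => ?_
  refine ContinuousLinearMap.ext_ring ?_
  have h1 := h I y
  rw [basisVector, delta, summand_eq_single, summand_eq_single] at h1
  exact h1

/-- Translation by `x` on `R/I`. -/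
def translate (x : R) (I : NonzeroIdeal R) (y : R ⧸ I.1) : R ⧸ I.1 := Ideal.Quotient.mk I.1 x + y

/-- `u x` acts on each summand `ℓ²(R/I)` by translation by `x`. -/
def opU (x : R) : HilbertSum R →L[ℂ] HilbertSum R :=
  (blockIsometry id Function.injective_id (translate x)
    (fun _ => add_right_injective _)).toContinuousLinearMap

theorem opU_basisVector (x : R) (I : NonzeroIdeal R) (y : R ⧸ I.1) :
    opU x (basisVector I y) = basisVector I (Ideal.Quotient.mk I.1 x + y) :=
  blockIsometry_basisVector id Function.injective_id (translate x)
    (fun _ => add_right_injective _) I y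

theorem NonzeroIdeal.mem_dilate {a : R⁰} {I : NonzeroIdeal R} {x : R} :
    x ∈ (I.dilate a).1 ↔ ∃ z ∈ I.1, (a : R) * z = x :=
  Ideal.mem_span_singleton_mul

theorem NonzeroIdeal.mul_mem_dilate {a : R⁰} {I : NonzeroIdeal R} {x : R} :
    (a : R) * x ∈ (I.dilate a).1 ↔ x ∈ I.1 := by
  rw [NonzeroIdeal.mem_dilate]
  constructor
  · rintro ⟨z, hz, h⟩
    exact mul_left_cancel₀ (nonZeroDivisors.coe_ne_zero a) h ▸ hz
  · exact fun h => ⟨x, h, rfl⟩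

theorem NonzeroIdeal.dilate_injective (a : R⁰) :
    Function.Injective (NonzeroIdeal.dilate a : NonzeroIdeal R → NonzeroIdeal R) := by
  intro I J h
  apply Subtype.ext
  ext x
  rw [← NonzeroIdeal.mul_mem_dilate (a := a), h, NonzeroIdeal.mul_mem_dilate]

/-- Multiplication by `a`, as a map `R/I → R/aI`. -/
def scale (a : R⁰) (I : NonzeroIdeal R) : R ⧸ I.1 → R ⧸ (I.dilate a).1 :=
  Submodule.mapQ I.1 (I.dilate a).1 (LinearMap.mulLeft R (a : R))
    (fun _ hx => NonzeroIdeal.mul_mem_dilate.mpr hx)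

theorem scale_mk (a : R⁰) (I : NonzeroIdeal R) (x : R) :
    scale a I (Ideal.Quotient.mk I.1 x) = Ideal.Quotient.mk (I.dilate a).1 (a * x) := rfl

theorem scale_injective (a : R⁰) (I : NonzeroIdeal R) : Function.Injective (scale a I) := by
  intro y z h
  obtain ⟨y, rfl⟩ := Ideal.Quotient.mk_surjective y
  obtain ⟨z, rfl⟩ := Ideal.Quotient.mk_surjective z
  rw [scale_mk, scale_mk, Ideal.Quotient.eq, ← mul_sub, NonzeroIdeal.mul_mem_dilate] at h
  exact Ideal.Quotient.eq.mpr h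

/-- `s a` acts by `ℓ²(R/I) ≅ ℓ²(aR/aI) ⊆ ℓ²(R/aI)`. -/
def opS (a : R⁰) : HilbertSum R →L[ℂ] HilbertSum R :=
  (blockIsometry (NonzeroIdeal.dilate a) (NonzeroIdeal.dilate_injective a) (scale a)
    (scale_injective a)).toContinuousLinearMap

theorem opS_basisVector (a : R⁰) (I : NonzeroIdeal R) (y : R ⧸ I.1) :
    opS a (basisVector I y) = basisVector (I.dilate a) (scale a I y) :=
  blockIsometry_basisVector (NonzeroIdeal.dilate a) (NonzeroIdeal.dilate_injective a) (scale a)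
    (scale_injective a) I y

/-- The subspace `⨁ I ⊆ J, ℓ²(J/I)` of `⨁ I, ℓ²(R/I)`: the closed span of the basis vectors at the
classes `x + I` with `I ⊆ J` and `x ∈ J`. -/
def idealSubspace (J : NonzeroIdeal R) : Submodule ℂ (HilbertSum R) :=
  (Submodule.span ℂ {ξ | ∃ (I : NonzeroIdeal R) (x : R), I.1 ≤ J.1 ∧ x ∈ J.1 ∧
    ξ = basisVector I (Ideal.Quotient.mk I.1 x)}).topologicalClosure

instance (J : NonzeroIdeal R) : CompleteSpace (idealSubspace J) :=
  (Submodule.isClosed_topologicalClosure _).completeSpace_coe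

/-- `e J` acts as the orthogonal projection onto `⨁ I ⊆ J, ℓ²(J/I)`. -/
def opE (J : NonzeroIdeal R) : HilbertSum R →L[ℂ] HilbertSum R :=
  (idealSubspace J).starProjection

theorem opE_basisVector_of_mem {I J : NonzeroIdeal R} (hIJ : I.1 ≤ J.1) {x : R} (hx : x ∈ J.1) :
    opE J (basisVector I (Ideal.Quotient.mk I.1 x)) =
      basisVector I (Ideal.Quotient.mk I.1 x) :=
  Submodule.starProjection_eq_self_iff.mpr
    (Submodule.le_topologicalClosure _ (Submodule.subset_span ⟨I, x, hIJ, hx, rfl⟩))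

theorem opE_basisVector_of_not {I J : NonzeroIdeal R} {x : R} (h : ¬ (I.1 ≤ J.1 ∧ x ∈ J.1)) :
    opE J (basisVector I (Ideal.Quotient.mk I.1 x)) = 0 := by
  refine (Submodule.starProjection_apply_eq_zero_iff _).mpr ?_
  rw [idealSubspace, Submodule.orthogonal_closure, Submodule.mem_orthogonal]
  intro v hv
  induction hv using Submodule.span_induction with
  | mem v hv =>
    obtain ⟨K, z, hK, hz, rfl⟩ := hv
    refine orthonormal_basisVector.2 (i := ⟨K, Ideal.Quotient.mk K.1 z⟩)
      (j := ⟨I, Ideal.Quotient.mk I.1 x⟩) fun h' => h ?_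
    obtain ⟨rfl, h2⟩ := Sigma.mk.inj_iff.mp h'
    have h3 := Ideal.Quotient.eq.mp (eq_of_heq h2)
    refine ⟨hK, ?_⟩
    have h4 := J.1.sub_mem hz (hK h3)
    rwa [sub_sub_cancel] at h4
  | zero => exact inner_zero_left _
  | add v w _ _ hv hw => rw [inner_add_left, hv, hw, add_zero]
  | smul c v _ hv => rw [inner_smul_left, hv, mul_zero]

theorem opU_star_mul_self (x : R) : star (opU x) * opU x = 1 :=
  LinearIsometry.adjoint_comp_self _

theorem opS_star_mul_self (a : R⁰) : star (opS a) * opS a = 1 :=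
  LinearIsometry.adjoint_comp_self _

theorem opE_star (J : NonzeroIdeal R) : star (opE J) = opE J :=
  isSelfAdjoint_starProjection (idealSubspace J)

theorem opE_mul_self (J : NonzeroIdeal R) : opE J * opE J = opE J :=
  Submodule.isIdempotentElem_starProjection (idealSubspace J)

/-- Bounded operators that agree on all the basis vectors at classes `x + I` are equal. -/
theorem operator_ext' {S T : HilbertSum R →L[ℂ] HilbertSum R}
    (h : ∀ (I : NonzeroIdeal R) (x : R), S (basisVector I (Ideal.Quotient.mk I.1 x)) =
      T (basisVector I (Ideal.Quotient.mk I.1 x))) : S = T :=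
  operator_ext fun I y => by
    obtain ⟨x, rfl⟩ := Ideal.Quotient.mk_surjective y
    exact h I x

theorem opU_mk (x : R) (I : NonzeroIdeal R) (y : R) :
    opU x (basisVector I (Ideal.Quotient.mk I.1 y)) =
      basisVector I (Ideal.Quotient.mk I.1 (x + y)) := by
  rw [opU_basisVector, map_add]

theorem opS_mk (a : R⁰) (I : NonzeroIdeal R) (y : R) :
    opS a (basisVector I (Ideal.Quotient.mk I.1 y)) =
      basisVector (I.dilate a) (Ideal.Quotient.mk (I.dilate a).1 (a * y)) := by
  rw [opS_basisVector, scale_mk]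

open Classical in
theorem opE_mk (J I : NonzeroIdeal R) (x : R) :
    opE J (basisVector I (Ideal.Quotient.mk I.1 x)) =
      if I.1 ≤ J.1 ∧ x ∈ J.1 then basisVector I (Ideal.Quotient.mk I.1 x) else 0 := by
  split_ifs with h
  · exact opE_basisVector_of_mem h.1 h.2
  · exact opE_basisVector_of_not h

theorem opU_mul (x y : R) : opU x * opU y = opU (x + y) := by
  refine operator_ext' fun I z => ?_
  rw [mul_apply_eq_comp, opU_mk, opU_mk, opU_mk, add_assoc]

theorem opU_zero : opU (0 : R) = 1 := by
  refine operator_ext' fun I z => ?_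
  rw [opU_mk, zero_add, one_apply_eq_self]

theorem opU_mul_star_self (x : R) : opU x * star (opU x) = 1 := by
  have h1 : opU x * opU (-x) = 1 := by rw [opU_mul, add_neg_cancel, opU_zero]
  have h2 : star (opU x) = opU (-x) := by
    calc star (opU x) = star (opU x) * (opU x * opU (-x)) := by rw [h1, mul_one]
      _ = opU (-x) := by rw [← mul_assoc, opU_star_mul_self, one_mul]
  rw [h2, h1]

theorem basisVector_congr {I J : NonzeroIdeal R} {x y : R} (h : I = J) (hxy : x = y) :
    basisVector I (Ideal.Quotient.mk I.1 x) = basisVector J (Ideal.Quotient.mk J.1 y) := by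
  subst h hxy; rfl

theorem NonzeroIdeal.dilate_le_dilate {a : R⁰} {I J : NonzeroIdeal R} :
    (I.dilate a).1 ≤ (J.dilate a).1 ↔ I.1 ≤ J.1 := by
  constructor
  · intro h x hx
    exact NonzeroIdeal.mul_mem_dilate.mp (h (NonzeroIdeal.mul_mem_dilate.mpr hx))
  · exact fun h => Ideal.mul_mono_right h

/-- A nonzero ideal contained in `aJ` is of the form `aI`. -/
theorem NonzeroIdeal.exists_dilate_of_le {a : R⁰} {I J : NonzeroIdeal R}
    (h : I.1 ≤ (J.dilate a).1) : ∃ K : NonzeroIdeal R, K.dilate a = I := by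
  have ha : ∀ x ∈ I.1, ∃ z, (a : R) * z ∈ I.1 ∧ (a : R) * z = x := fun x hx => by
    obtain ⟨z, -, rfl⟩ := NonzeroIdeal.mem_dilate.mp (h hx)
    exact ⟨z, hx, rfl⟩
  refine ⟨⟨Submodule.comap (LinearMap.mulLeft R (a : R)) I.1, fun h0 => I.2 ?_⟩, ?_⟩
  · refine (Submodule.eq_bot_iff _).mpr fun x hx => ?_
    obtain ⟨z, hz, rfl⟩ := ha x hx
    rw [show z = 0 from (Submodule.eq_bot_iff _).mp h0 z hz, mul_zero]
  · refine Subtype.ext (Ideal.ext fun x => NonzeroIdeal.mem_dilate.trans ⟨?_, fun hx => ha x hx⟩)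
    rintro ⟨z, hz, rfl⟩
    exact hz

theorem opS_opE (a : R⁰) (J : NonzeroIdeal R) : opS a * opE J = opE (J.dilate a) * opS a := by
  refine operator_ext' fun I x => ?_
  rw [mul_apply_eq_comp, mul_apply_eq_comp, opS_mk]
  by_cases h : I.1 ≤ J.1 ∧ x ∈ J.1
  · rw [opE_basisVector_of_mem h.1 h.2, opS_mk, opE_basisVector_of_mem
      (NonzeroIdeal.dilate_le_dilate.mpr h.1) (NonzeroIdeal.mul_mem_dilate.mpr h.2)]
  · rw [opE_basisVector_of_not h, map_zero, opE_basisVector_of_not fun h' =>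
      h ⟨NonzeroIdeal.dilate_le_dilate.mp h'.1, NonzeroIdeal.mul_mem_dilate.mp h'.2⟩]

theorem opS_star_opE (a : R⁰) (J : NonzeroIdeal R) :
    opS a * star (opS a) * opE (J.dilate a) = opE (J.dilate a) := by
  refine operator_ext' fun I x => ?_
  rw [mul_apply_eq_comp, opE_mk]
  split_ifs with h
  · obtain ⟨K, rfl⟩ := NonzeroIdeal.exists_dilate_of_le h.1
    obtain ⟨z, -, rfl⟩ := NonzeroIdeal.mem_dilate.mp h.2
    rw [← opS_mk, ← mul_apply_eq_comp, mul_assoc, opS_star_mul_self, mul_one]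
  · rw [map_zero]

theorem opS_opE_star (a : R⁰) (J : NonzeroIdeal R) :
    opS a * opE J * star (opS a) = opE (J.dilate a) := by
  have h := congrArg star (opS_star_opE a J)
  rw [star_mul, star_mul, star_star, opE_star] at h
  rw [opS_opE, mul_assoc, h]

/-- The operators `opU x`, `opS a`, `opE I` satisfy the defining relations. -/
theorem isFamily_op : IsFamily (opU (R := R)) opS opE := by
  intro p q h
  cases h with
  | u_star_mul_self x => exact opU_star_mul_self x
  | u_mul_star_self x => exact opU_mul_star_self x
  | u_mul_u x y => exact opU_mul x y
  | s_star_mul_self a => exact opS_star_mul_self a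
  | s_mul_s a b =>
    refine operator_ext' fun I z => ?_
    rw [mul_apply_eq_comp, opS_mk, opS_mk, opS_mk]
    refine basisVector_congr (Subtype.ext ?_) ?_
    · change Ideal.span _ * (Ideal.span _ * I.1) = Ideal.span _ * I.1
      rw [← mul_assoc, Ideal.span_singleton_mul_span_singleton, Submonoid.coe_mul]
    · rw [Submonoid.coe_mul, mul_assoc]
  | s_mul_u a x =>
    refine operator_ext' fun I z => ?_
    rw [mul_apply_eq_comp, mul_apply_eq_comp, opU_mk, opS_mk, opS_mk,
      opU_mk, mul_add]
  | e_star I => exact opE_star I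
  | e_mul_self I => exact opE_mul_self I
  | e_inter J K =>
    refine operator_ext' fun I z => ?_
    rw [mul_apply_eq_comp]
    by_cases hK : I.1 ≤ K.1 ∧ z ∈ K.1
    · rw [opE_basisVector_of_mem hK.1 hK.2]
      by_cases hJ : I.1 ≤ J.1 ∧ z ∈ J.1
      · rw [opE_basisVector_of_mem hJ.1 hJ.2,
          opE_basisVector_of_mem (J := J.inter K) (le_inf hJ.1 hK.1) ⟨hJ.2, hK.2⟩]
      · rw [opE_basisVector_of_not hJ, opE_basisVector_of_not (J := J.inter K) fun h =>
          hJ ⟨h.1.trans inf_le_left, h.2.1⟩]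
    · rw [opE_basisVector_of_not hK, map_zero, opE_basisVector_of_not (J := J.inter K) fun h =>
        hK ⟨h.1.trans inf_le_right, h.2.2⟩]
  | e_unit =>
    refine operator_ext' fun I z => ?_
    exact opE_basisVector_of_mem (J := NonzeroIdeal.unit R) le_top Submodule.mem_top
  | s_e_s a I => exact opS_opE_star a I
  | u_e_of_mem J x hx =>
    refine operator_ext' fun I z => ?_
    rw [mul_apply_eq_comp, mul_apply_eq_comp, opU_mk, opE_mk, opE_mk,
      J.1.add_mem_iff_right hx]
    split_ifs
    · rw [opU_mk]
    · rw [map_zero]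
  | e_u_e_of_notMem J x hx =>
    refine operator_ext' fun I z => ?_
    rw [mul_apply_eq_comp, mul_apply_eq_comp, opE_mk]
    by_cases h : I.1 ≤ J.1 ∧ z ∈ J.1
    · rw [if_pos h, opU_mk, opE_mk, if_neg fun h' => hx ((J.1.add_mem_iff_left h.2).mp h'.2)]
      rfl
    · rw [if_neg h, map_zero, map_zero]
      rfl

/-- The natural representation `μ` of the Toeplitz algebra on `⨁ I, ℓ²(R/I)`, which is determined
by `u x ↦ opU x`, `s a ↦ opS a` and `e I ↦ opE I`. -/
def naturalRep (R : Type*) [CommRing R] [IsDomain R] :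
    Toeplitz R →⋆ₐ[ℂ] (HilbertSum R →L[ℂ] HilbertSum R) :=
  Toeplitz.lift opU opS opE isFamily_op

end Representation

end RingToeplitz

end

set_option linter.unusedSectionVars false

/-! ### Almost invariant finite sets -/

/-- A commutative group has finite subsets that are almost invariant under multiplication by the
elements of a given finite set. -/
@[to_additive]
theorem exists_finset_card_filter_mul_mem_ge {A : Type*} [CommGroup A] [DecidableEq A]
    (S : Finset A) {ε : ℝ} (hε : 0 < ε) :
    ∃ F : Finset A, F.Nonempty ∧ ∀ g ∈ S,
      (1 - ε) * (F.card : ℝ) ≤ ((F.filter fun p => g * p ∈ F).card : ℝ) := by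
  let F : ℕ → Finset A := fun n =>
    (Fintype.piFinset fun _ : S => Finset.range n).image fun e => ∏ s : S, (s : A) ^ e s
  have hcard (n : ℕ) : (F n).card ≤ n ^ S.card := by
    refine Finset.card_image_le.trans ?_
    simp
  have hsub (n : ℕ) : F n ⊆ F (n + 1) := by
    refine Finset.image_subset_image fun e he => ?_
    rw [Fintype.mem_piFinset] at he ⊢
    intro s
    have := Finset.mem_range.mp (he s)
    exact Finset.mem_range.mpr (by omega)
  have hmul (n : ℕ) (g : A) (hg : g ∈ S) (p : A) (hp : p ∈ F n) : g * p ∈ F (n + 1) := by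
    obtain ⟨e, he, rfl⟩ := Finset.mem_image.mp hp
    rw [Fintype.mem_piFinset] at he
    refine Finset.mem_image.mpr ⟨fun s => e s + if s = ⟨g, hg⟩ then 1 else 0, ?_, ?_⟩
    · rw [Fintype.mem_piFinset]
      intro s
      have := Finset.mem_range.mp (he s)
      refine Finset.mem_range.mpr ?_
      split_ifs <;> omega
    · simp only [pow_add, Finset.prod_mul_distrib, pow_ite, pow_one, pow_zero]
      rw [Finset.prod_ite_eq' Finset.univ (⟨g, hg⟩ : S) fun s => (s : A),
        if_pos (Finset.mem_univ _), mul_comm]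
  have hpos : (F 1).Nonempty := by
    refine Finset.Nonempty.image ⟨fun _ => 0, ?_⟩ _
    rw [Fintype.mem_piFinset]
    simp
  have hpos' (n : ℕ) : (F (n + 1)).Nonempty := by
    induction n with
    | zero => exact hpos
    | succ n ih => exact ih.mono (hsub _)
  have key : ∃ n : ℕ, ((F (n + 2)).card : ℝ) ≤ (1 + ε) * (F (n + 1)).card := by
    by_contra! h
    have hgrow (n : ℕ) : (1 + ε) ^ n ≤ ((F (n + 1)).card : ℝ) := by
      induction n with
      | zero =>
        have : 1 ≤ (F 1).card := hpos.card_pos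
        simpa using this
      | succ n ih =>
        calc (1 + ε) ^ (n + 1) = (1 + ε) * (1 + ε) ^ n := pow_succ' _ _
          _ ≤ (1 + ε) * (F (n + 1)).card := by gcongr
          _ ≤ _ := (h n).le
    have ht := tendsto_pow_const_div_const_pow_of_one_lt S.card (r := 1 + ε) (by linarith)
    have hev := (ht.eventually_lt_const (u := (1 + ε)⁻¹) (by positivity)).and
      (Filter.eventually_ge_atTop 1)
    obtain ⟨m, hm, hm1⟩ := hev.exists
    obtain ⟨n, rfl⟩ : ∃ n, m = n + 1 := ⟨m - 1, by omega⟩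
    rw [div_lt_iff₀ (by positivity), pow_succ', inv_mul_cancel_left₀ (by positivity)] at hm
    have h1 : ((F (n + 1)).card : ℝ) ≤ ((n + 1 : ℕ) : ℝ) ^ S.card := by
      exact_mod_cast hcard (n + 1)
    linarith [hgrow n]
  obtain ⟨n, hn⟩ := key
  refine ⟨F (n + 1), hpos' n, fun g hg => ?_⟩
  have h1 : ((F (n + 1)).filter fun p => ¬ g * p ∈ F (n + 1)).card ≤
      (F (n + 2) \ F (n + 1)).card := by
    refine Finset.card_le_card_of_injOn (fun p => g * p) (fun p hp => ?_)
      (mul_right_injective g).injOn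
    have hp' := Finset.mem_filter.mp hp
    exact Finset.mem_sdiff.mpr ⟨hmul _ g hg p hp'.1, hp'.2⟩
  have h2 := Finset.card_filter_add_card_filter_not (s := F (n + 1)) fun p => g * p ∈ F (n + 1)
  have h3 := Finset.card_sdiff_add_card_eq_card (hsub (n + 1))
  have h1' : (((F (n + 1)).filter fun p => ¬ g * p ∈ F (n + 1)).card : ℝ) ≤
      ((F (n + 2) \ F (n + 1)).card : ℝ) := by exact_mod_cast h1
  have h2' : (((F (n + 1)).filter fun p => g * p ∈ F (n + 1)).card : ℝ) +
      (((F (n + 1)).filter fun p => ¬ g * p ∈ F (n + 1)).card : ℝ) = ((F (n + 1)).card : ℝ) := by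
    exact_mod_cast h2
  have h3' : ((F (n + 2) \ F (n + 1)).card : ℝ) + ((F (n + 1)).card : ℝ) =
      ((F (n + 2)).card : ℝ) := by exact_mod_cast h3
  linarith

/-- The affine transformation `(z, c) ↦ (x + a z, a c)` of `K × Kˣ` attached to `(x, a)`: left
translation by `(x, a)` in the `ax + b`-group of `K`. -/
def affineShift {K : Type*} [Field K] (g : K × Kˣ) : Equiv.Perm (K × Kˣ) where
  toFun p := (g.1 + g.2 * p.1, g.2 * p.2)
  invFun p := ((g.2⁻¹ : Kˣ) * (p.1 - g.1), g.2⁻¹ * p.2)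
  left_inv p := by ext <;> simp
  right_inv p := by ext <;> simp

theorem affineShift_apply {K : Type*} [Field K] (g p : K × Kˣ) :
    affineShift g p = (g.1 + g.2 * p.1, g.2 * p.2) := rfl

theorem affineShift_injective {K : Type*} [Field K] {g h p : K × Kˣ}
    (H : affineShift g p = affineShift h p) : g = h := by
  simp only [affineShift_apply, Prod.mk.injEq] at H
  have h2 : g.2 = h.2 := mul_right_cancel H.2
  refine Prod.ext ?_ h2
  have h1 := H.1
  rw [h2] at h1
  exact add_right_cancel h1

/-- The `ax + b`-group of a field has almost invariant finite sets. -/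
theorem exists_finset_card_filter_affineShift_mem_ge {K : Type*} [Field K] [DecidableEq K]
    [DecidableEq Kˣ] (S : Finset (K × Kˣ)) {ε : ℝ} (hε : 0 < ε) :
    ∃ F : Finset (K × Kˣ), F.Nonempty ∧ ∀ g ∈ S,
      (1 - ε) * (F.card : ℝ) ≤ ((F.filter fun p => affineShift g p ∈ F).card : ℝ) := by
  wlog hε1 : ε ≤ 1 generalizing ε
  · obtain ⟨F, hF, h⟩ := this one_pos le_rfl
    refine ⟨F, hF, fun g hg => le_trans ?_ (h g hg)⟩
    gcongr
    exact (not_le.mp hε1).le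
  obtain ⟨C, hC, hCS⟩ := exists_finset_card_filter_mul_mem_ge (S.image Prod.snd) (half_pos hε)
  obtain ⟨B, hB, hBS⟩ := exists_finset_card_filter_add_mem_ge (A := K)
    ((S ×ˢ C).image fun q => (((q.1.2 * q.2)⁻¹ : Kˣ) : K) * q.1.1) (half_pos hε)
  have hinj : Function.Injective fun q : Kˣ × K => ((q.1 * q.2, q.1) : K × Kˣ) := by
    rintro ⟨c, b⟩ ⟨c', b'⟩ h
    simp only [Prod.mk.injEq] at h
    obtain ⟨h1, rfl⟩ := h
    simpa using h1
  refine ⟨(C ×ˢ B).image fun q => (q.1 * q.2, q.1), (hC.product hB).image _, fun g hg => ?_⟩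
  rw [Finset.card_image_of_injective _ hinj, Finset.card_product]
  let D := (C.filter fun c => g.2 * c ∈ C).sigma fun c =>
    B.filter fun b => (((g.2 * c)⁻¹ : Kˣ) : K) * g.1 + b ∈ B
  have hD : D.card ≤ (((C ×ˢ B).image fun q : Kˣ × K => ((q.1 * q.2, q.1) : K × Kˣ)).filter
      fun p => affineShift g p ∈
        (C ×ˢ B).image fun q : Kˣ × K => ((q.1 * q.2, q.1) : K × Kˣ)).card := by
    refine Finset.card_le_card_of_injOn (fun q => (q.1 * q.2, q.1)) ?_ ?_
    · rintro ⟨c, b⟩ hq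
      simp only [D, Finset.coe_sigma, Set.mem_sigma_iff, Finset.mem_coe, Finset.mem_filter] at hq
      obtain ⟨⟨hc, hgc⟩, hb, hgb⟩ := hq
      refine Finset.mem_filter.mpr ⟨Finset.mem_image.mpr
        ⟨(c, b), Finset.mem_product.mpr ⟨hc, hb⟩, rfl⟩, Finset.mem_image.mpr
        ⟨(g.2 * c, _), Finset.mem_product.mpr ⟨hgc, hgb⟩, ?_⟩⟩
      refine Prod.ext ?_ rfl
      change ((g.2 * c : Kˣ) : K) * _ = g.1 + g.2 * (c * b)
      rw [mul_add, Units.mul_inv_cancel_left, Units.val_mul, mul_assoc]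
    · rintro ⟨c, b⟩ - ⟨c', b'⟩ - h
      have := hinj (a₁ := (c, b)) (a₂ := (c', b')) h
      simp only [Prod.mk.injEq] at this
      obtain ⟨rfl, rfl⟩ := this
      rfl
  have hD' : (1 - ε / 2) * C.card * ((1 - ε / 2) * B.card) ≤ (D.card : ℝ) := by
    rw [Finset.card_sigma, Nat.cast_sum]
    calc _ ≤ ((C.filter fun c => g.2 * c ∈ C).card : ℝ) * ((1 - ε / 2) * B.card) := by
          refine mul_le_mul_of_nonneg_right
            (hCS g.2 (Finset.mem_image_of_mem _ hg)) ?_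
          have : 0 ≤ 1 - ε / 2 := by linarith
          positivity
      _ ≤ _ := by
          rw [← nsmul_eq_mul]
          refine Finset.card_nsmul_le_sum _ _ _ fun c hc => ?_
          exact hBS _ (Finset.mem_image.mpr ⟨(g, c), Finset.mem_product.mpr
            ⟨hg, (Finset.mem_filter.mp hc).1⟩, rfl⟩)
  have hD'' : (D.card : ℝ) ≤ _ := Nat.cast_le.mpr hD
  refine le_trans ?_ (hD'.trans hD'')
  rw [Nat.cast_mul]
  have : 0 ≤ (C.card : ℝ) * B.card := by positivity
  nlinarith [mul_nonneg (sq_nonneg (ε / 2)) this]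

/-! ### States and projections in `C*`-algebras -/

section CStar

open scoped ComplexOrder

variable {A : Type*} [CStarAlgebra A] [PartialOrder A] [StarOrderedRing A]

/-- A functional of norm at most one that takes the value one at `1` is nonnegative on
nonnegative elements. -/
theorem nonneg_of_norm_le_one_of_map_one (f : A →L[ℂ] ℂ) (hf : ‖f‖ ≤ 1) (h1 : f 1 = 1) {a : A}
    (ha : 0 ≤ a) : 0 ≤ f a := by
  have hle (x : A) : ‖f x‖ ≤ ‖x‖ := by
    simpa using f.le_of_opNorm_le hf x
  have hmap (r : ℂ) : f (algebraMap ℂ A r) = r := by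
    rw [Algebra.algebraMap_eq_smul_one, map_smul, h1, smul_eq_mul, mul_one]
  have hsa : star a = a := (IsSelfAdjoint.of_nonneg ha).star_eq
  have him : (f a).im = 0 := by
    have hb (t : ℝ) : ((f a).im + t) ^ 2 ≤ ‖a‖ ^ 2 * ‖(1 : A)‖ + t ^ 2 * ‖(1 : A)‖ := by
      have e1 : star (a + algebraMap ℂ A (t * Complex.I)) * (a + algebraMap ℂ A (t * Complex.I)) =
          a * a + algebraMap ℂ A (t ^ 2 : ℝ) := by
        rw [star_add, hsa, ← algebraMap_star_comm, add_mul, mul_add, mul_add,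
          Algebra.commutes (star _) a, ← map_mul]
        have e2 : star ((t : ℂ) * Complex.I) = - (t * Complex.I) := by simp
        rw [e2, map_neg, mul_neg]
        have e3 : -(↑t * Complex.I) * (↑t * Complex.I) = ((t ^ 2 : ℝ) : ℂ) := by
          push_cast; ring_nf; simp
        rw [e3]; abel
      have e4 : ‖a + algebraMap ℂ A (t * Complex.I)‖ ^ 2 ≤ ‖a‖ ^ 2 * ‖(1 : A)‖ + t ^ 2 * ‖(1 : A)‖ := by
        rw [sq, ← CStarRing.norm_star_mul_self, e1]
        refine (norm_add_le _ _).trans (add_le_add ?_ ?_)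
        · rcases subsingleton_or_nontrivial A with h | h
          · simp [Subsingleton.elim a 0]
          · rw [norm_one, mul_one, sq]; exact norm_mul_le _ _
        · rw [norm_algebraMap]; simp
      have e5 := hle (a + algebraMap ℂ A (t * Complex.I))
      rw [map_add, hmap] at e5
      have e6 : |(f a + t * Complex.I).im| ≤ ‖f a + t * Complex.I‖ := Complex.abs_im_le_norm _
      have e7 : (f a + t * Complex.I).im = (f a).im + t := by simp
      rw [e7] at e6
      calc ((f a).im + t) ^ 2 = |(f a).im + t| ^ 2 := (sq_abs _).symm
        _ ≤ ‖a + algebraMap ℂ A (t * Complex.I)‖ ^ 2 :=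
          pow_le_pow_left₀ (abs_nonneg _) (e6.trans e5) 2
        _ ≤ _ := e4
    have hn : ‖(1 : A)‖ = 1 := by
      rcases subsingleton_or_nontrivial A with h | h
      · have : f 1 = 0 := by rw [Subsingleton.elim (1 : A) 0, map_zero]
        rw [this] at h1; exact absurd h1 zero_ne_one
      · exact norm_one
    simp only [hn, mul_one] at hb
    by_contra hne
    have := hb ((‖a‖ ^ 2 + 1) / (f a).im)
    have h2 : (f a).im * ((‖a‖ ^ 2 + 1) / (f a).im) = ‖a‖ ^ 2 + 1 := by field_simp
    nlinarith [sq_nonneg (f a).im, sq_nonneg ‖a‖]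
  have hre : 0 ≤ (f a).re := by
    have h2 : ‖algebraMap ℂ A (‖a‖ : ℝ) - a‖ ≤ ‖a‖ := by
      have h3 : 0 ≤ algebraMap ℂ A (‖a‖ : ℝ) - a :=
        sub_nonneg.mpr (IsSelfAdjoint.of_nonneg ha).le_algebraMap_norm_self
      rw [CStarAlgebra.norm_le_iff_le_algebraMap _ (norm_nonneg a) h3]
      exact sub_le_self _ ha
    have h4 := (hle _).trans h2
    rw [map_sub, hmap] at h4
    have h5 := (Complex.abs_re_le_norm _).trans h4
    rw [Complex.sub_re, Complex.ofReal_re] at h5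
    linarith [le_of_abs_le h5]
  exact Complex.nonneg_iff.mpr ⟨hre, him.symm⟩

/-- The norm of a nonnegative element is attained at a state. -/
theorem exists_positive_map_one_apply_eq_norm [Nontrivial A] {a : A} (ha : 0 ≤ a) :
    ∃ f : A →ₚ[ℂ] ℂ, f 1 = 1 ∧ f a = ‖a‖ := by
  have key : ∃ g : A →L[ℂ] ℂ, ‖g‖ ≤ 1 ∧ g 1 = 1 ∧ g a = ‖a‖ := by
    have h1 : 1 + ‖a‖ ≤ ‖1 + a‖ := by
      have h2 := CStarAlgebra.norm_mem_spectrum_of_nonneg ha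
      have h3 : 1 + ‖a‖ ∈ spectrum ℝ (1 + a) := by
        have := spectrum.singleton_add_eq (R := ℝ) a 1
        rw [map_one] at this
        exact this ▸ Set.add_mem_add (Set.mem_singleton _) h2
      have h4 := spectrum.norm_le_norm_of_mem h3
      rwa [Real.norm_of_nonneg (by positivity)] at h4
    have h0 : (1 + a) ≠ 0 := by
      intro h
      rw [h, norm_zero] at h1
      linarith [norm_nonneg a]
    obtain ⟨g, hg, hga⟩ := exists_dual_vector ℂ (1 + a) (norm_ne_zero_iff.mpr h0)
    refine ⟨g, hg.le, ?_⟩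
    have hle (x : A) : ‖g x‖ ≤ ‖x‖ := by simpa using g.le_of_opNorm_le hg.le x
    rw [map_add] at hga
    have h5 := hle 1
    rw [norm_one] at h5
    have h6 := hle a
    have h7 : (g 1).re + (g a).re = ‖1 + a‖ := by
      have := congrArg Complex.re hga
      simpa using this
    have h8 := Complex.re_le_norm (g 1)
    have h9 := Complex.re_le_norm (g a)
    have e1 : (g 1).re = ‖g 1‖ := by linarith
    have e2 : (g a).re = ‖g a‖ := by linarith
    have n1 : ‖g 1‖ = 1 := by linarith
    have n2 : ‖g a‖ = ‖a‖ := by linarith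
    have hh (z : ℂ) (hz : z.re = ‖z‖) : z = (‖z‖ : ℂ) := by
      have : 0 ≤ z := Complex.re_eq_norm.mp hz
      exact (Complex.norm_of_nonneg' this).symm
    refine ⟨?_, ?_⟩
    · rw [hh _ e1, n1, Complex.ofReal_one]
    · rw [hh _ e2, n2]
  obtain ⟨g, hg, h1, hga⟩ := key
  exact ⟨PositiveLinearMap.mk₀ g.toLinearMap fun x hx =>
    nonneg_of_norm_le_one_of_map_one g hg h1 hx, h1, hga⟩

/-- The norm of an element is attained at a unit vector in some representation. -/
theorem exists_representation_norm_apply_eq.{v} {A : Type v} [CStarAlgebra A] [Nontrivial A]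
    (a : A) : ∃ (H : Type v) (_ : NormedAddCommGroup H) (_ : InnerProductSpace ℂ H) (_ : CompleteSpace H)
      (π : A →⋆ₐ[ℂ] (H →L[ℂ] H)) (ξ : H), ‖ξ‖ = 1 ∧ ‖π a ξ‖ = ‖a‖ := by
  let _ := CStarAlgebra.spectralOrder A
  have _ := CStarAlgebra.spectralOrderedRing A
  obtain ⟨f, h1, hf⟩ := exists_positive_map_one_apply_eq_norm (star_mul_self_nonneg a)
  have hn (b : A) (hb : f (star b * b) = (‖b‖ ^ 2 : ℝ)) : ‖f.toPreGNS b‖ = ‖b‖ := by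
    have h := f.preGNS_norm_sq (f.toPreGNS b)
    rw [PositiveLinearMap.ofPreGNS_toPreGNS, hb] at h
    have h' : ‖f.toPreGNS b‖ ^ 2 = ‖b‖ ^ 2 := by exact_mod_cast h
    exact (pow_left_inj₀ (norm_nonneg _) (norm_nonneg _) two_ne_zero).mp h'
  refine ⟨f.GNS, inferInstance, inferInstance, inferInstance, f.gnsStarAlgHom,
    (f.toPreGNS 1 : f.PreGNS), ?_, ?_⟩
  · rw [UniformSpace.Completion.norm_coe, hn, norm_one]
    simp [h1]
  · have : f.gnsStarAlgHom a ((f.toPreGNS 1 : f.PreGNS) : f.GNS) =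
        ((f.toPreGNS a : f.PreGNS) : f.GNS) := by
      simp [PositiveLinearMap.gnsStarAlgHom_apply]
    rw [this, UniformSpace.Completion.norm_coe, hn]
    rw [hf, CStarRing.norm_star_mul_self, sq]

/-- If a projection `p` commutes with `y`, then `‖y‖` is the larger one of `‖p y‖` and
`‖(1 - p) y‖`. -/
theorem norm_le_of_norm_projection_mul_le {A : Type*} [CStarAlgebra A] {p y : A} (hp : star p = p)
    (hpp : p * p = p) (hpy : p * y = y * p) {M : ℝ} (h1 : ‖p * y‖ ≤ M)
    (h2 : ‖(1 - p) * y‖ ≤ M) : ‖y‖ ≤ M := by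
  let _ := CStarAlgebra.spectralOrder A
  have _ := CStarAlgebra.spectralOrderedRing A
  have hM : 0 ≤ M := (norm_nonneg _).trans h1
  have key (q : A) (hq : star q = q) (hqq : q * q = q) (hqy : q * y = y * q) (h : ‖q * y‖ ≤ M) :
      star y * q * y ≤ (M ^ 2 : ℝ) • q := by
    have e1 : star y * q * y = star q * (star (q * y) * (q * y)) * q := by
      have e2 : star y * q = q * star y := by
        have := congrArg star hqy
        rw [star_mul, star_mul, hq] at this
        exact this
      rw [star_mul, hq]
      calc star y * q * y = star y * (q * (q * (q * q))) * y := by rw [hqq, hqq, hqq]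
        _ = (star y * q) * q * q * (q * y) := by simp only [mul_assoc]
        _ = (q * star y) * q * q * (y * q) := by rw [e2, hqy]
        _ = q * (star y * q * (q * y)) * q := by simp only [mul_assoc]
    rw [e1]
    refine (CStarAlgebra.star_left_conjugate_le_norm_smul (hb := .star_mul_self (q * y))).trans ?_
    rw [hq, hqq]
    refine smul_le_smul_of_nonneg_right ?_ ?_
    · rw [CStarRing.norm_star_mul_self, ← sq]
      exact pow_le_pow_left₀ (norm_nonneg _) h 2
    · rw [← hqq]; nth_rewrite 1 [← hq]; exact star_mul_self_nonneg q
  have k1 := key p hp hpp hpy h1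
  have k2 := key (1 - p) (by rw [star_sub, star_one, hp])
    (by rw [sub_mul, mul_sub, mul_sub, hpp]; simp) (by rw [sub_mul, mul_sub, hpy]; simp) h2
  have k3 : star y * y ≤ algebraMap ℝ A (M ^ 2) := by
    have := add_le_add k1 k2
    rw [← smul_add, add_sub_cancel, ← add_mul, ← mul_add, add_sub_cancel, mul_one] at this
    rwa [Algebra.algebraMap_eq_smul_one]
  have k4 := (CStarAlgebra.norm_le_iff_le_algebraMap _ (sq_nonneg M) (star_mul_self_nonneg y)).mpr k3
  rw [CStarRing.norm_star_mul_self, ← sq] at k4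
  exact (sq_le_sq₀ (norm_nonneg y) hM).mp k4

end CStar

/-! ### Operators on `ℓ²(X; H)` -/

section WeightedShift

open scoped ENNReal InnerProductSpace

variable {X H : Type*} [NormedAddCommGroup H] [InnerProductSpace ℂ H]

theorem memℓp_weightedShift (σ : Equiv.Perm X) (a : H →L[ℂ] H) (v : lp (fun _ : X => H) 2) :
    Memℓp (fun q => a (v (σ.symm q))) 2 := by
  have h := (lp.memℓp v).summable (by norm_num)
  refine memℓp_gen (p := 2) ?_
  have h' := ((σ.symm.summable_iff (f := fun q => ‖v q‖ ^ (2 : ℝ≥0∞).toReal)).mpr h).mul_left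
    (‖a‖ ^ (2 : ℝ≥0∞).toReal)
  refine Summable.of_nonneg_of_le (fun q => by positivity) (fun q => ?_) h'
  simp only [Function.comp]
  rw [← Real.mul_rpow (norm_nonneg _) (norm_nonneg _)]
  exact Real.rpow_le_rpow (norm_nonneg _) (a.le_opNorm _) (by norm_num)

/-- The operator on `ℓ²(X; H)` with `δ_p ⊗ v ↦ δ_{σ p} ⊗ a v`. -/
noncomputable def weightedShift (σ : Equiv.Perm X) (a : H →L[ℂ] H) :
    lp (fun _ : X => H) 2 →L[ℂ] lp (fun _ : X => H) 2 :=
  LinearMap.mkContinuous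
    { toFun := fun v => ⟨fun q => a (v (σ.symm q)), memℓp_weightedShift σ a v⟩
      map_add' := fun v w => by ext q; exact map_add a _ _
      map_smul' := fun c v => by ext q; exact map_smul a _ _ } ‖a‖ fun v => by
    refine lp.norm_le_of_forall_sum_le (by norm_num) (by positivity) fun s => ?_
    have h2 : (2 : ℝ≥0∞).toReal = 2 := by norm_num
    have h := lp.sum_rpow_le_norm_rpow (by norm_num) v (s.map σ.symm.toEmbedding)
    rw [Finset.sum_map] at h
    simp only [h2] at h ⊢
    rw [Real.mul_rpow (norm_nonneg _) (norm_nonneg _)]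
    refine le_trans ?_ (mul_le_mul_of_nonneg_left h (by positivity))
    rw [Finset.mul_sum]
    refine Finset.sum_le_sum fun q _ => ?_
    rw [← Real.mul_rpow (norm_nonneg _) (norm_nonneg _)]
    exact Real.rpow_le_rpow (norm_nonneg _) (a.le_opNorm _) (by norm_num)

theorem weightedShift_apply (σ : Equiv.Perm X) (a : H →L[ℂ] H) (v : lp (fun _ : X => H) 2)
    (q : X) : weightedShift σ a v q = a (v (σ.symm q)) := rfl

theorem weightedShift_mul (σ τ : Equiv.Perm X) (a b : H →L[ℂ] H) :
    weightedShift σ a * weightedShift τ b = weightedShift (σ * τ) (a * b) := by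
  ext v q
  rfl

theorem weightedShift_one : weightedShift (1 : Equiv.Perm X) (1 : H →L[ℂ] H) = 1 := by
  ext v q
  rfl

theorem weightedShift_zero (σ : Equiv.Perm X) : weightedShift σ (0 : H →L[ℂ] H) = 0 := by
  ext v q
  rfl

theorem weightedShift_single [DecidableEq X] (σ : Equiv.Perm X) (a : H →L[ℂ] H) (p : X) (v : H) :
    weightedShift σ a (lp.single 2 p v) = lp.single 2 (σ p) (a v) := by
  ext q
  rw [weightedShift_apply, lp.single_apply, lp.single_apply, Pi.single_apply, Pi.single_apply]
  by_cases h : q = σ p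
  · subst h; simp
  · rw [if_neg h, if_neg (fun h' => h (by rw [← h', Equiv.apply_symm_apply])), map_zero]

theorem star_weightedShift [CompleteSpace H] (σ : Equiv.Perm X) (a : H →L[ℂ] H) :
    star (weightedShift σ a) = weightedShift σ⁻¹ (star a) := by
  symm
  refine (ContinuousLinearMap.eq_adjoint_iff _ _).mpr fun v w => ?_
  rw [lp.inner_eq_tsum, lp.inner_eq_tsum, ← σ.symm.tsum_eq]
  refine tsum_congr fun q => ?_
  rw [weightedShift_apply, weightedShift_apply, ContinuousLinearMap.star_eq_adjoint,
    ContinuousLinearMap.adjoint_inner_left]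
  congr 2
  exact congrArg (fun x => v x) (σ.apply_symm_apply q)

/-- Multipliers coming from almost invariant vectors are contractive: `φ σ` is the proportion of
the points of `F` that `σ` maps into `F`. -/
theorem norm_sum_card_smul_apply_le [DecidableEq X] {ι : Type*} (s : Finset ι)
    (σ : ι → Equiv.Perm X) (c : ι → ℂ) (a : ι → H →L[ℂ] H) (F : Finset X) (hF : F.Nonempty)
    (v : H) :
    ‖(∑ i ∈ s, (((F.filter fun p => σ i p ∈ F).card / F.card : ℝ) : ℂ) • c i • a i) v‖ ≤
      ‖∑ i ∈ s, c i • weightedShift (σ i) (a i)‖ * ‖v‖ := by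
  set Φ := ∑ i ∈ s, (((F.filter fun p => σ i p ∈ F).card / F.card : ℝ) : ℂ) • c i • a i with hΦ
  set D := ∑ i ∈ s, c i • weightedShift (σ i) (a i) with hD
  set w := Φ v with hw
  have hn : (0 : ℝ) < F.card := by exact_mod_cast hF.card_pos
  let V (x : H) : lp (fun _ : X => H) 2 := ∑ p ∈ F, lp.single 2 p x
  have hV (x : H) : ‖V x‖ ^ 2 = F.card * ‖x‖ ^ 2 := by
    have h := lp.norm_sum_single (p := 2) (E := fun _ : X => H) (by norm_num) (fun _ => x) F
    have h2 : (2 : ℝ≥0∞).toReal = 2 := by norm_num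
    simp only [h2, Real.rpow_two, Finset.sum_const, nsmul_eq_mul] at h
    exact h
  have hinner : ⟪V w, D (V v)⟫_ℂ = F.card * ‖w‖ ^ 2 := by
    have h1 (i : ι) : ⟪V w, weightedShift (σ i) (a i) (V v)⟫_ℂ =
        ((F.filter fun p => σ i p ∈ F).card : ℂ) * ⟪w, a i v⟫_ℂ := by
      simp only [V, map_sum, weightedShift_single, inner_sum]
      rw [Finset.card_filter, Nat.cast_sum, Finset.sum_mul]
      refine Finset.sum_congr rfl fun p _ => ?_
      rw [sum_inner]
      simp only [lp.inner_single_left, lp.single_apply, Pi.single_apply]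
      have h2 (q : X) : ⟪w, if q = σ i p then a i v else 0⟫_ℂ =
          if q = σ i p then ⟪w, a i v⟫_ℂ else 0 := by
        split_ifs <;> simp
      simp only [h2, Finset.sum_ite_eq']
      split_ifs <;> simp
    have h3 : (⟪w, w⟫_ℂ : ℂ) = ‖w‖ ^ 2 := inner_self_eq_norm_sq_to_K w
    rw [← h3]
    nth_rewrite 3 [hw]
    rw [hΦ, hD]
    simp only [sum_apply, smul_apply, inner_sum,
      inner_smul_right, h1, Finset.mul_sum]
    refine Finset.sum_congr rfl fun i _ => ?_
    have : (F.card : ℂ) ≠ 0 := by exact_mod_cast hn.ne'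
    push_cast
    field_simp
  have hle : F.card * ‖w‖ ^ 2 ≤ ‖D‖ * (F.card * (‖w‖ * ‖v‖)) := by
    have h1 : ‖(⟪V w, D (V v)⟫_ℂ : ℂ)‖ = F.card * ‖w‖ ^ 2 := by
      rw [hinner]; simp
    rw [← h1]
    have h2 : ‖V w‖ * ‖V v‖ = F.card * (‖w‖ * ‖v‖) := by
      refine (pow_left_inj₀ (by positivity) (by positivity) two_ne_zero).mp ?_
      rw [mul_pow, hV, hV]; ring
    calc _ ≤ ‖V w‖ * ‖D (V v)‖ := norm_inner_le_norm _ _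
      _ ≤ ‖V w‖ * (‖D‖ * ‖V v‖) := by gcongr; exact D.le_opNorm _
      _ = ‖D‖ * (‖V w‖ * ‖V v‖) := by ring
      _ = _ := by rw [h2]
  rcases (norm_nonneg w).eq_or_lt with h | h
  · rw [← h]; positivity
  · have : (F.card * ‖w‖) * ‖w‖ ≤ (F.card * ‖w‖) * (‖D‖ * ‖v‖) := by nlinarith
    exact le_of_mul_le_mul_left this (by positivity)

end WeightedShift

/-! ### Monomials in a family that satisfies the relations -/

namespace RingToeplitz

open scoped nonZeroDivisors

variable {R : Type*} [CommRing R] [IsDomain R]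

namespace NonzeroIdeal

/-- The sum `I + J` of two nonzero ideals. -/
def sup (I J : NonzeroIdeal R) : NonzeroIdeal R :=
  ⟨I.1 ⊔ J.1, fun h => I.2 (le_bot_iff.mp (le_sup_left.trans_eq h))⟩

theorem inter_eq_left {I J : NonzeroIdeal R} (h : I.1 ≤ J.1) : I.inter J = I :=
  Subtype.ext (inf_eq_left.mpr h)

theorem inter_comm (I J : NonzeroIdeal R) : I.inter J = J.inter I :=
  Subtype.ext (_root_.inf_comm I.1 J.1)

theorem mem_dilate_unit {a : R⁰} {x : R} : x ∈ ((unit R).dilate a).1 ↔ (a : R) ∣ x := by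
  rw [mem_dilate]
  exact ⟨fun ⟨z, _, hz⟩ => ⟨z, hz.symm⟩, fun ⟨z, hz⟩ => ⟨z, Submodule.mem_top, hz.symm⟩⟩

end NonzeroIdeal

namespace IsFamily

variable {A : Type*} [Ring A] [StarRing A] {u : R → A} {s : R⁰ → A} {e : NonzeroIdeal R → A}
  (h : IsFamily u s e)

include h

theorem u_mul (x y : R) : u x * u y = u (x + y) := h _ _ (.u_mul_u x y)

theorem u_zero : u 0 = 1 := by
  have h1 : u 0 * u 0 = u 0 := by rw [h.u_mul, add_zero]
  calc u 0 = star (u 0) * u 0 * u 0 := by rw [h _ _ (.u_star_mul_self 0), one_mul]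
    _ = 1 := by rw [mul_assoc, h1, h _ _ (.u_star_mul_self 0)]

theorem star_u (x : R) : star (u x) = u (-x) := by
  calc star (u x) = star (u x) * (u x * u (-x)) := by
        rw [h.u_mul, add_neg_cancel, h.u_zero, mul_one]
    _ = u (-x) := by rw [← mul_assoc, h _ _ (.u_star_mul_self x), one_mul]

theorem s_mul (a b : R⁰) : s a * s b = s (a * b) := h _ _ (.s_mul_s a b)

theorem star_s_mul_s (a : R⁰) : star (s a) * s a = 1 := h _ _ (.s_star_mul_self a)

theorem s_one : s 1 = 1 := by
  calc s 1 = star (s 1) * s 1 * s 1 := by rw [h.star_s_mul_s, one_mul]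
    _ = 1 := by rw [mul_assoc, h.s_mul, mul_one, h.star_s_mul_s]

theorem s_mul_u (a : R⁰) (x : R) : s a * u x = u (a * x) * s a := h _ _ (.s_mul_u a x)

theorem u_mul_star_s (a : R⁰) (x : R) : u x * star (s a) = star (s a) * u (a * x) := by
  have := congrArg star (h.s_mul_u a (-x))
  rw [star_mul, star_mul, h.star_u, h.star_u, mul_neg, neg_neg, neg_neg] at this
  exact this

theorem star_e (I : NonzeroIdeal R) : star (e I) = e I := h _ _ (.e_star I)

theorem e_mul (I J : NonzeroIdeal R) : e I * e J = e (I.inter J) := (h _ _ (.e_inter I J)).symm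

theorem e_unit : e (NonzeroIdeal.unit R) = 1 := h _ _ .e_unit

theorem s_mul_e (a : R⁰) (I : NonzeroIdeal R) : s a * e I = e (I.dilate a) * s a := by
  rw [← h _ _ (.s_e_s a I), mul_assoc, h.star_s_mul_s, mul_one]

theorem e_mul_star_s (a : R⁰) (I : NonzeroIdeal R) :
    e I * star (s a) = star (s a) * e (I.dilate a) := by
  rw [← h _ _ (.s_e_s a I), ← mul_assoc, ← mul_assoc, h.star_s_mul_s, one_mul]

theorem s_mul_star_s_self (a : R⁰) : s a * star (s a) = e ((NonzeroIdeal.unit R).dilate a) := by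
  rw [← h _ _ (.s_e_s a _), h.e_unit, mul_one]

theorem s_mul_star_s (a b : R⁰) :
    s a * star (s b) = star (s b) * e ((NonzeroIdeal.unit R).dilate (b * a)) * s a := by
  rw [← h.s_mul_star_s_self]
  nth_rewrite 2 [mul_comm b a]
  rw [← h.s_mul, ← h.s_mul, star_mul]
  simp only [mul_assoc, h.star_s_mul_s, mul_one]
  rw [← mul_assoc, h.star_s_mul_s, one_mul]

theorem e_mul_u_of_mem {I : NonzeroIdeal R} {x : R} (hx : x ∈ I.1) : e I * u x = u x * e I :=
  (h _ _ (.u_e_of_mem I x hx)).symm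

theorem e_mul_u_mul_e_of_notMem {I J : NonzeroIdeal R} {x : R} (hx : x ∉ I.1 ⊔ J.1) :
    e I * u x * e J = 0 := by
  have h1 : e I = e I * e (I.sup J) := by
    rw [h.e_mul, NonzeroIdeal.inter_eq_left le_sup_left]
  have h2 : e J = e (I.sup J) * e J := by
    rw [h.e_mul, NonzeroIdeal.inter_comm, NonzeroIdeal.inter_eq_left le_sup_right]
  rw [h1, h2]
  calc e I * e (I.sup J) * u x * (e (I.sup J) * e J)
      = e I * (e (I.sup J) * u x * e (I.sup J)) * e J := by simp only [mul_assoc]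
    _ = 0 := by rw [h _ _ (.e_u_e_of_notMem _ x hx), mul_zero, zero_mul]

theorem e_mul_u_mul_e {I J : NonzeroIdeal R} {x y : R} (hx : x ∈ I.1) (hy : y ∈ J.1) :
    e I * u (x + y) * e J = u x * e (I.inter J) * u y := by
  rw [← h.u_mul, ← mul_assoc, h.e_mul_u_of_mem hx, ← h.e_mul]
  simp only [mul_assoc]
  rw [h.e_mul_u_of_mem hy]

theorem e_mul_u_mul_e_eq (I J : NonzeroIdeal R) (x : R) : e I * u x * e J = 0 ∨
    ∃ y z, y + z = x ∧ e I * u x * e J = u y * e (I.inter J) * u z := by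
  by_cases hx : x ∈ I.1 ⊔ J.1
  · obtain ⟨y, hy, z, hz, rfl⟩ := Submodule.mem_sup.mp hx
    exact Or.inr ⟨y, z, rfl, h.e_mul_u_mul_e hy hz⟩
  · exact Or.inl (h.e_mul_u_mul_e_of_notMem hx)

end IsFamily

/-- The projection `u x e I u (-x)` that belongs to the coset `x + I`. -/
def cosetProj {A : Type*} [Ring A] (u : R → A) (e : NonzeroIdeal R → A) (x : R)
    (I : NonzeroIdeal R) : A := u x * e I * u (-x)

namespace IsFamily

variable {A : Type*} [Ring A] [StarRing A] {u : R → A} {s : R⁰ → A} {e : NonzeroIdeal R → A}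
  (h : IsFamily u s e)

include h

theorem star_cosetProj (x : R) (I : NonzeroIdeal R) :
    star (cosetProj u e x I) = cosetProj u e x I := by
  simp only [cosetProj, star_mul, h.star_u, h.star_e, neg_neg, mul_assoc]

theorem cosetProj_mul_cosetProj_same (x : R) (I J : NonzeroIdeal R) :
    cosetProj u e x I * cosetProj u e x J = cosetProj u e x (I.inter J) := by
  have h1 : u (-x) * u x = 1 := by rw [h.u_mul, neg_add_cancel, h.u_zero]
  calc u x * e I * u (-x) * (u x * e J * u (-x))
      = u x * (e I * (u (-x) * u x) * e J) * u (-x) := by simp only [mul_assoc]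
    _ = _ := by rw [h1, mul_one, h.e_mul]; rfl

theorem cosetProj_mul_self (x : R) (I : NonzeroIdeal R) :
    cosetProj u e x I * cosetProj u e x I = cosetProj u e x I := by
  rw [h.cosetProj_mul_cosetProj_same, NonzeroIdeal.inter_eq_left le_rfl]

theorem cosetProj_eq {x y : R} {I : NonzeroIdeal R} (hxy : x - y ∈ I.1) :
    cosetProj u e x I = cosetProj u e y I := by
  have h1 : u x = u y * u (x - y) := by rw [h.u_mul, add_sub_cancel]
  have h2 : u (-y) = u (x - y) * u (-x) := by rw [h.u_mul]; congr 1; ring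
  rw [cosetProj, cosetProj, h1, h2, mul_assoc (u y), ← h.e_mul_u_of_mem hxy]
  simp only [mul_assoc]

theorem cosetProj_mul_of_mem {x y z : R} {I J : NonzeroIdeal R} (hx : z - x ∈ I.1)
    (hy : z - y ∈ J.1) : cosetProj u e x I * cosetProj u e y J = cosetProj u e z (I.inter J) := by
  rw [← h.cosetProj_eq hx, ← h.cosetProj_eq hy, h.cosetProj_mul_cosetProj_same]

theorem cosetProj_mul_of_disjoint {x y : R} {I J : NonzeroIdeal R}
    (hxy : ∀ z, z - x ∈ I.1 → z - y ∉ J.1) : cosetProj u e x I * cosetProj u e y J = 0 := by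
  have h1 : -x + y ∉ I.1 ⊔ J.1 := by
    intro h1
    obtain ⟨i, hi, j, hj, hij⟩ := Submodule.mem_sup.mp h1
    refine hxy (x + i) (by simpa using hi) ?_
    have : x + i - y = -j := by linear_combination hij
    rw [this]
    exact J.1.neg_mem hj
  calc u x * e I * u (-x) * (u y * e J * u (-y))
      = u x * (e I * (u (-x) * u y) * e J) * u (-y) := by simp only [mul_assoc]
    _ = 0 := by rw [h.u_mul, h.e_mul_u_mul_e_of_notMem h1, mul_zero, zero_mul]

theorem cosetProj_commute (x y : R) (I J : NonzeroIdeal R) :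
    cosetProj u e x I * cosetProj u e y J = cosetProj u e y J * cosetProj u e x I := by
  by_cases hz : ∃ z, z - x ∈ I.1 ∧ z - y ∈ J.1
  · obtain ⟨z, hx, hy⟩ := hz
    rw [h.cosetProj_mul_of_mem hx hy, h.cosetProj_mul_of_mem hy hx, NonzeroIdeal.inter_comm]
  · push Not at hz
    rw [h.cosetProj_mul_of_disjoint hz, h.cosetProj_mul_of_disjoint fun z hy hx => hz z hx hy]

end IsFamily

/-- The data of a monomial `(s a)* u x e I u y s b`. -/
structure MonomialIndex (R : Type*) [CommRing R] where
  /-- The left denominator. -/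
  a : R⁰
  /-- The left translation. -/
  x : R
  /-- The ideal. -/
  I : NonzeroIdeal R
  /-- The right translation. -/
  y : R
  /-- The right dilation. -/
  b : R⁰

/-- The monomial `(s a)* u x e I u y s b`. -/
def monomial {A : Type*} [Ring A] [StarRing A] (u : R → A) (s : R⁰ → A) (e : NonzeroIdeal R → A)
    (i : MonomialIndex R) : A :=
  star (s i.a) * u i.x * e i.I * u i.y * s i.b

namespace IsFamily

variable {A : Type*} [Ring A] [StarRing A] {u : R → A} {s : R⁰ → A} {e : NonzeroIdeal R → A}
  (h : IsFamily u s e)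

include h

theorem one_eq_monomial : 1 = monomial u s e ⟨1, 0, NonzeroIdeal.unit R, 0, 1⟩ := by
  simp [monomial, h.s_one, h.u_zero, h.e_unit]

theorem u_mul_monomial (z : R) (i : MonomialIndex R) :
    u z * monomial u s e i = monomial u s e ⟨i.a, i.a * z + i.x, i.I, i.y, i.b⟩ := by
  simp only [monomial, ← mul_assoc, h.u_mul_star_s]
  rw [mul_assoc (star (s i.a)), h.u_mul]

theorem star_s_mul_monomial (c : R⁰) (i : MonomialIndex R) :
    star (s c) * monomial u s e i = monomial u s e ⟨i.a * c, i.x, i.I, i.y, i.b⟩ := by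
  simp only [monomial, ← mul_assoc, ← star_mul, h.s_mul]

theorem e_mul_monomial (J : NonzeroIdeal R) (i : MonomialIndex R) :
    e J * monomial u s e i = 0 ∨ ∃ j, e J * monomial u s e i = monomial u s e j := by
  have h1 : e J * monomial u s e i =
      star (s i.a) * (e (J.dilate i.a) * u i.x * e i.I) * u i.y * s i.b := by
    simp only [monomial, ← mul_assoc, h.e_mul_star_s]
  rw [h1]
  rcases h.e_mul_u_mul_e_eq (J.dilate i.a) i.I i.x with h2 | ⟨y, z, -, h2⟩
  · left; rw [h2, mul_zero, zero_mul, zero_mul]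
  · right
    refine ⟨⟨i.a, y, (J.dilate i.a).inter i.I, z + i.y, i.b⟩, ?_⟩
    rw [h2]
    simp only [monomial, ← h.u_mul, mul_assoc]

theorem s_mul_monomial (c : R⁰) (i : MonomialIndex R) :
    s c * monomial u s e i = 0 ∨ ∃ j, s c * monomial u s e i = monomial u s e j := by
  let j : MonomialIndex R := ⟨1, c * i.x, i.I.dilate c, c * i.y, c * i.b⟩
  have h1 : s c * monomial u s e i = star (s i.a) *
      (e ((NonzeroIdeal.unit R).dilate (i.a * c)) * monomial u s e j) := by
    have h2 : s c * u i.x * e i.I * u i.y * s i.b = monomial u s e j := by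
      simp only [monomial, j, h.s_one, star_one, one_mul, ← h.s_mul]
      rw [h.s_mul_u, mul_assoc _ (s c), h.s_mul_e, ← mul_assoc, mul_assoc _ (s c), h.s_mul_u]
      simp only [mul_assoc]
    rw [← h2]
    simp only [monomial, ← mul_assoc, h.s_mul_star_s]
  rw [h1]
  rcases h.e_mul_monomial ((NonzeroIdeal.unit R).dilate (i.a * c)) j with h2 | ⟨k, h2⟩
  · left; rw [h2, mul_zero]
  · right; rw [h2, h.star_s_mul_monomial]; exact ⟨_, rfl⟩

/-- Multiplying a monomial by a multiple of its denominator. -/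
theorem s_mul_monomial_eq (c : R⁰) (i : MonomialIndex R) :
    s (c * i.a) * monomial u s e i = 0 ∨ ∃ w L, s (c * i.a) * monomial u s e i =
      cosetProj u e w L * (u (c * (i.x + i.y)) * s (c * i.b)) := by
  have h1 : s (c * i.a) * monomial u s e i =
      s c * (e ((NonzeroIdeal.unit R).dilate i.a) * u i.x * e i.I) * u i.y * s i.b := by
    rw [← h.s_mul, ← h.s_mul_star_s_self]
    simp only [monomial, mul_assoc]
  rw [h1]
  rcases h.e_mul_u_mul_e_eq ((NonzeroIdeal.unit R).dilate i.a) i.I i.x with h2 | ⟨y, z, hyz, h2⟩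
  · left; rw [h2, mul_zero, zero_mul, zero_mul]
  · right
    refine ⟨c * y, ((((NonzeroIdeal.unit R).dilate i.a).inter i.I).dilate c), ?_⟩
    rw [h2]
    calc s c * (u y * e (((NonzeroIdeal.unit R).dilate i.a).inter i.I) * u z) * u i.y * s i.b
        = s c * u y * e (((NonzeroIdeal.unit R).dilate i.a).inter i.I) * (u z * u i.y) * s i.b := by
          simp only [mul_assoc]
      _ = u (c * y) * e ((((NonzeroIdeal.unit R).dilate i.a).inter i.I).dilate c) *
          u (c * (z + i.y)) * (s c * s i.b) := by
          rw [h.s_mul_u, mul_assoc _ (s c), h.s_mul_e, h.u_mul, ← mul_assoc, mul_assoc _ (s c),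
            h.s_mul_u]
          simp only [mul_assoc]
      _ = _ := by
          have h3 : (c : R) * (z + i.y) = -(c * y) + c * (i.x + i.y) := by rw [← hyz]; ring
          rw [h3, ← h.u_mul, h.s_mul, cosetProj]
          simp only [mul_assoc]

end IsFamily

/-- Homomorphisms preserve monomials. -/
theorem map_monomial {A B : Type*} [Ring A] [StarRing A] [Algebra ℂ A] [Ring B] [StarRing B]
    [Algebra ℂ B] (φ : A →⋆ₐ[ℂ] B) (u : R → A) (s : R⁰ → A) (e : NonzeroIdeal R → A)
    (i : MonomialIndex R) :
    φ (monomial u s e i) = monomial (fun x => φ (u x)) (fun a => φ (s a)) (fun I => φ (e I)) i := by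
  simp only [monomial, map_mul, map_star]

namespace Toeplitz

/-- The linear combinations of monomials, as a linear map to the Toeplitz algebra. -/
noncomputable def ofMonomials (R : Type*) [CommRing R] [IsDomain R] :
    (MonomialIndex R →₀ ℂ) →ₗ[ℂ] Toeplitz R :=
  Finsupp.linearCombination ℂ (monomial u s e)

theorem ofMonomials_apply (c : MonomialIndex R →₀ ℂ) :
    ofMonomials R c = ∑ i ∈ c.support, c i • monomial u s e i := rfl

/-- The linear combinations of monomials are dense in the Toeplitz algebra. -/
theorem denseRange_ofMonomials : DenseRange (ofMonomials R) := by
  have hmem (i : MonomialIndex R) : monomial u s e i ∈ LinearMap.range (ofMonomials R) :=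
    ⟨Finsupp.single i 1, by simp [ofMonomials]⟩
  have hgen (g : Toeplitz R) (hg : ∀ i, g * monomial u s e i ∈ LinearMap.range (ofMonomials R))
      (t : Toeplitz R) (ht : t ∈ LinearMap.range (ofMonomials R)) :
      g * t ∈ LinearMap.range (ofMonomials R) := by
    obtain ⟨c, rfl⟩ := ht
    rw [ofMonomials_apply, Finset.mul_sum]
    refine Submodule.sum_mem _ fun i _ => ?_
    rw [mul_smul_comm]
    exact Submodule.smul_mem _ _ (hg i)
  have hzero {t : Toeplitz R} (ht : t = 0 ∨ ∃ j, t = monomial u s e j) :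
      t ∈ LinearMap.range (ofMonomials R) := by
    rcases ht with rfl | ⟨j, rfl⟩
    · exact Submodule.zero_mem _
    · exact hmem j
  have hstar (g : Gen R) : ((Free.ι (g, true) : Free R) : Toeplitz R) =
      star ((Free.ι (g, false) : Free R) : Toeplitz R) := by
    rw [star_coe, Free.star_ι]; rfl
  have key (x : Free R) : ∀ t ∈ LinearMap.range (ofMonomials R),
      (x : Toeplitz R) * t ∈ LinearMap.range (ofMonomials R) := by
    induction x using Free.induction with
    | h0 r =>
      intro t ht
      rw [show ((algebraMap ℂ (Free R) r : Free R) : Toeplitz R) = algebraMap ℂ _ r from rfl,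
        ← Algebra.smul_def]
      exact Submodule.smul_mem _ _ ht
    | h1 g =>
      refine hgen _ fun i => ?_
      rcases g with ⟨x | a | J, _ | _⟩
      · exact hzero (.inr ⟨_, isFamily.u_mul_monomial _ i⟩)
      · rw [hstar, show star ((Free.ι (Gen.u x, false) : Free R) : Toeplitz R) = u (-x) from
          isFamily.star_u x]
        exact hzero (.inr ⟨_, isFamily.u_mul_monomial _ i⟩)
      · exact hzero (isFamily.s_mul_monomial _ i)
      · rw [hstar]
        exact hzero (.inr ⟨_, isFamily.star_s_mul_monomial _ i⟩)
      · exact hzero (isFamily.e_mul_monomial _ i)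
      · rw [hstar, show star ((Free.ι (Gen.e J, false) : Free R) : Toeplitz R) = e J from
          isFamily.star_e J]
        exact hzero (isFamily.e_mul_monomial _ i)
    | hmul a b ha hb =>
      intro t ht
      rw [UniformSpace.Completion.coe_mul, mul_assoc]
      exact ha _ (hb _ ht)
    | hadd a b ha hb =>
      intro t ht
      rw [UniformSpace.Completion.coe_add, add_mul]
      exact Submodule.add_mem _ (ha _ ht) (hb _ ht)
  refine (UniformSpace.Completion.denseRange_coe (α := Free R)).mono ?_
  rintro _ ⟨x, rfl⟩
  have h1 := key x 1 (by rw [isFamily.one_eq_monomial]; exact hmem _)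
  rwa [mul_one] at h1

end Toeplitz

end RingToeplitz

/-! ### The grading by the `ax + b`-group and its multipliers -/

theorem affineShift_mul {K : Type*} [Field K] (g h : K × Kˣ) :
    affineShift g * affineShift h = affineShift (g.1 + g.2 * h.1, g.2 * h.2) := by
  refine Equiv.ext fun p => ?_
  simp only [Equiv.Perm.mul_apply, affineShift_apply, Units.val_mul]
  refine Prod.ext ?_ (mul_assoc _ _ _).symm
  simp only
  ring

namespace RingToeplitz

open scoped nonZeroDivisors

variable {R : Type*} [CommRing R] [IsDomain R]

/-- A nonzero element of `R` as a unit of the fraction field. -/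
noncomputable def fractionUnit : R⁰ →* (FractionRing R)ˣ :=
  IsUnit.liftRight ((algebraMap R (FractionRing R) : R →* FractionRing R).comp R⁰.subtype)
    (fun a => IsLocalization.map_units (FractionRing R) a)

theorem coe_fractionUnit (a : R⁰) :
    (fractionUnit a : FractionRing R) = algebraMap R (FractionRing R) a :=
  IsUnit.coe_liftRight _ _ a

theorem fractionUnit_injective : Function.Injective (fractionUnit (R := R)) := by
  intro a b hab
  have := congrArg Units.val hab
  rw [coe_fractionUnit, coe_fractionUnit] at this
  exact Subtype.ext (IsFractionRing.injective R (FractionRing R) this)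

/-- The degree of a monomial in the `ax + b`-group of the fraction field. -/
noncomputable def MonomialIndex.degree (i : MonomialIndex R) :
    FractionRing R × (FractionRing R)ˣ :=
  ((fractionUnit i.a)⁻¹ * algebraMap R (FractionRing R) (i.x + i.y),
    (fractionUnit i.a)⁻¹ * fractionUnit i.b)

/-- The translation that belongs to `u x`. -/
noncomputable def permU (x : R) : Equiv.Perm (FractionRing R × (FractionRing R)ˣ) :=
  affineShift (algebraMap R (FractionRing R) x, 1)

/-- The dilation that belongs to `s a`. -/
noncomputable def permS (a : R⁰) : Equiv.Perm (FractionRing R × (FractionRing R)ˣ) :=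
  affineShift (0, fractionUnit a)

theorem permU_mul_permU (x y : R) : permU x * permU y = permU (x + y) := by
  simp [permU, affineShift_mul]

theorem permS_mul_permS (a b : R⁰) : permS a * permS b = permS (a * b) := by
  simp [permS, affineShift_mul]

theorem permS_mul_permU (a : R⁰) (x : R) : permS a * permU x = permU (a * x) * permS a := by
  simp [permS, permU, affineShift_mul, coe_fractionUnit]

theorem affineShift_degree (i : MonomialIndex R) :
    affineShift i.degree = (permS i.a)⁻¹ * permU i.x * permU i.y * permS i.b := by
  rw [mul_assoc, mul_assoc, eq_inv_mul_iff_mul_eq, ← mul_assoc (permU _), permU_mul_permU]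
  simp [MonomialIndex.degree, permS, permU, affineShift_mul]

section Coaction

variable {H : Type*} [NormedAddCommGroup H] [InnerProductSpace ℂ H] [CompleteSpace H]
  {u : R → H →L[ℂ] H} {s : R⁰ → H →L[ℂ] H} {e : NonzeroIdeal R → H →L[ℂ] H}

/-- A family on `H` that satisfies the relations gives rise to one on `ℓ²(G; H)`, where `G` is the
`ax + b`-group. -/
theorem IsFamily.weightedShiftFamily (h : IsFamily u s e) :
    IsFamily (fun x => weightedShift (permU x) (u x)) (fun a => weightedShift (permS a) (s a))
      (fun I => weightedShift 1 (e I)) := by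
  intro p q hpq
  cases hpq <;> try simp only [star_weightedShift, weightedShift_mul, inv_mul_cancel, mul_inv_cancel,
    mul_one, one_mul, inv_one, permU_mul_permU, permS_mul_permS, permS_mul_permU]
  case u_star_mul_self x => rw [h _ _ (.u_star_mul_self x), weightedShift_one]
  case u_mul_star_self x => rw [h _ _ (.u_mul_star_self x), weightedShift_one]
  case u_mul_u x y => rw [h _ _ (.u_mul_u x y)]
  case s_star_mul_self a => rw [h _ _ (.s_star_mul_self a), weightedShift_one]
  case s_mul_s a b => rw [h _ _ (.s_mul_s a b)]
  case s_mul_u a x => rw [h _ _ (.s_mul_u a x)]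
  case e_star I => rw [h _ _ (.e_star I)]
  case e_mul_self I => rw [h _ _ (.e_mul_self I)]
  case e_inter I J => rw [h _ _ (.e_inter I J)]
  case e_unit => rw [h _ _ .e_unit, weightedShift_one]
  case s_e_s a I => rw [h _ _ (.s_e_s a I)]
  case u_e_of_mem I x hx => rw [h _ _ (.u_e_of_mem I x hx)]
  case e_u_e_of_notMem I x hx => rw [h _ _ (.e_u_e_of_notMem I x hx), weightedShift_zero]

theorem monomial_weightedShift (i : MonomialIndex R) :
    monomial (fun x => weightedShift (permU x) (u x)) (fun a => weightedShift (permS a) (s a))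
      (fun I => weightedShift 1 (e I)) i =
      weightedShift (affineShift i.degree) (monomial u s e i) := by
  simp only [monomial, star_weightedShift, weightedShift_mul, mul_one, affineShift_degree]

end Coaction

namespace Toeplitz

theorem isFamily_comp {B : Type*} [CStarAlgebra B] (φ : Toeplitz R →⋆ₐ[ℂ] B) :
    IsFamily (fun x => φ (u x)) (fun a => φ (s a)) (fun I => φ (e I)) := by
  have hst (x : Toeplitz R) : φ (star x) = star (φ x) := map_star φ x
  have key : ∀ p q : Toeplitz R, Rel u s e p q → φ p = φ q := fun p q h => by rw [isFamily p q h]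
  intro p q h
  cases h with
  | u_star_mul_self x => simpa [hst] using key _ _ (.u_star_mul_self x)
  | u_mul_star_self x => simpa [hst] using key _ _ (.u_mul_star_self x)
  | u_mul_u x y => simpa [hst] using key _ _ (.u_mul_u x y)
  | s_star_mul_self a => simpa [hst] using key _ _ (.s_star_mul_self a)
  | s_mul_s a b => simpa [hst] using key _ _ (.s_mul_s a b)
  | s_mul_u a x => simpa [hst] using key _ _ (.s_mul_u a x)
  | e_star I => simpa [hst] using key _ _ (.e_star I)
  | e_mul_self I => simpa [hst] using key _ _ (.e_mul_self I)
  | e_inter I J => simpa [hst] using key _ _ (.e_inter I J)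
  | e_unit => simpa [hst] using key _ _ .e_unit
  | s_e_s a I => simpa [hst] using key _ _ (.s_e_s a I)
  | u_e_of_mem I x hx => simpa [hst] using key _ _ (.u_e_of_mem I x hx)
  | e_u_e_of_notMem I x hx => simpa [hst] using key _ _ (.e_u_e_of_notMem I x hx)

open Classical in
/-- The proportion of the points of `F` that left translation by `g` maps into `F`. -/
noncomputable def overlap {K : Type*} [Field K] (F : Finset (K × Kˣ)) (g : K × Kˣ) : ℝ :=
  (F.filter fun p => affineShift g p ∈ F).card / F.card

theorem overlap_nonneg {K : Type*} [Field K] (F : Finset (K × Kˣ)) (g : K × Kˣ) :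
    0 ≤ overlap F g := by unfold overlap; positivity

open Classical in
theorem overlap_le_one {K : Type*} [Field K] (F : Finset (K × Kˣ)) (g : K × Kˣ) :
    overlap F g ≤ 1 :=
  div_le_one_of_le₀ (by exact_mod_cast Finset.card_filter_le _ _) (by positivity)

open Classical in
theorem finite_overlap_ne_zero {K : Type*} [Field K] (F : Finset (K × Kˣ)) :
    {g | overlap F g ≠ 0}.Finite := by
  have hsub : {g | overlap F g ≠ 0} ⊆
      ⋃ p ∈ F, ⋃ q ∈ F, {g | affineShift g p = q} := by
    intro g hg
    have h1 : (F.filter fun p => affineShift g p ∈ F).Nonempty := by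
      rw [Finset.nonempty_iff_ne_empty]
      intro h
      exact hg (by simp [overlap, h])
    obtain ⟨p, hp⟩ := h1
    obtain ⟨hp, hgp⟩ := Finset.mem_filter.mp hp
    simp only [Set.mem_iUnion]
    exact ⟨p, hp, _, hgp, rfl⟩
  refine Set.Finite.subset ?_ hsub
  refine F.finite_toSet.biUnion fun p _ => F.finite_toSet.biUnion fun q _ => ?_
  refine Set.Subsingleton.finite fun g hg g' hg' => ?_
  exact affineShift_injective (hg.trans hg'.symm)

/-- Multiplying the coefficients of a linear combination of monomials by the function
`overlap F` of their degrees does not increase the norm. -/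
theorem norm_sum_overlap_smul_le (F : Finset (FractionRing R × (FractionRing R)ˣ))
    (hF : F.Nonempty) (c : MonomialIndex R →₀ ℂ) :
    ‖∑ i ∈ c.support, (overlap F i.degree : ℂ) • c i • monomial u s e i‖ ≤
      ‖ofMonomials R c‖ := by
  classical
  rcases subsingleton_or_nontrivial (Toeplitz R) with hT | hT
  · rw [Subsingleton.elim (∑ i ∈ c.support, _) (ofMonomials R c)]
  set Φ := ∑ i ∈ c.support, (overlap F i.degree : ℂ) • c i • monomial u s e i with hΦ
  obtain ⟨H, _, _, _, π, ξ, hξ, hπ⟩ := exists_representation_norm_apply_eq Φ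
  have hfam := (isFamily_comp π).weightedShiftFamily
  have h1 := norm_sum_card_smul_apply_le c.support (fun i => affineShift i.degree) c
    (fun i => π (monomial u s e i)) F hF ξ
  have h2 : π Φ = ∑ i ∈ c.support, (overlap F i.degree : ℂ) • c i • π (monomial u s e i) := by
    simp only [hΦ, map_sum, map_smul]
  have h3 : lift _ _ _ hfam (ofMonomials R c) = ∑ i ∈ c.support,
      c i • weightedShift (affineShift i.degree) (π (monomial u s e i)) := by
    rw [ofMonomials_apply]
    simp only [map_sum, map_smul, map_monomial, lift_u, lift_s, lift_e, monomial_weightedShift]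
  have h4 : ‖π Φ ξ‖ ≤ ‖lift _ _ _ hfam (ofMonomials R c)‖ * ‖ξ‖ := by
    have h5 (g : FractionRing R × (FractionRing R)ˣ) :
        overlap F g = (F.filter fun p => affineShift g p ∈ F).card / F.card := by
      unfold overlap
      congr!
    rw [h2, h3]
    simp only [h5]
    exact h1
  rw [hξ, mul_one, hπ] at h4
  exact h4.trans (NonUnitalStarAlgHom.norm_apply_le _ _)

end Toeplitz

end RingToeplitz

/-! ### Linear combinations of commuting projections -/

open Classical in
/-- If a linear combination of commuting projections has norm larger than `M` on a projection `q`,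
then `q` dominates a nonzero element on which each of the projections acts as `0` or `1` and the
linear combination as a scalar of modulus larger than `M`. -/
theorem exists_mul_projection_eq {A : Type*} [CStarAlgebra A] {ι : Type*} (s : Finset ι)
    (p : ι → A) (hp : ∀ i, star (p i) = p i) (hpp : ∀ i, p i * p i = p i)
    (hcomm : ∀ i j, p i * p j = p j * p i) (c : ι → ℂ) {M : ℝ} (hM : 0 ≤ M) (c₀ : ℂ) (q : A)
    (hq : star q = q) (hqq : q * q = q) (hqp : ∀ i, q * p i = p i * q)
    (h : M < ‖q * (algebraMap ℂ A c₀ + ∑ i ∈ s, c i • p i)‖) :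
    ∃ q' : A, q' ≠ 0 ∧ q' * q = q' ∧ (∀ i ∈ s, q' * p i = q' ∨ q' * p i = 0) ∧
      M < ‖c₀ + ∑ i ∈ s, if q' * p i = q' then c i else 0‖ := by
  induction s using Finset.induction_on generalizing c₀ q with
  | empty =>
    rw [Finset.sum_empty, add_zero, Algebra.algebraMap_eq_smul_one, mul_smul_comm, mul_one,
      norm_smul] at h
    refine ⟨q, ?_, hqq, by simp, ?_⟩
    · rintro rfl
      rw [norm_zero, mul_zero] at h
      exact absurd h hM.not_gt
    · rw [Finset.sum_empty, add_zero]
      refine h.trans_le (mul_le_of_le_one_right (norm_nonneg _) ?_)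
      have h1 : ‖q‖ * ‖q‖ = ‖q‖ := by
        rw [← CStarRing.norm_star_mul_self, hq, hqq]
      nlinarith [norm_nonneg q]
  | insert k s hk ih =>
    set y := q * (algebraMap ℂ A c₀ + ∑ i ∈ insert k s, c i • p i) with hy
    have hpsum (t : Finset ι) : p k * ∑ i ∈ t, c i • p i = (∑ i ∈ t, c i • p i) * p k := by
      rw [Finset.mul_sum, Finset.sum_mul]
      refine Finset.sum_congr rfl fun i _ => ?_
      rw [mul_smul_comm, smul_mul_assoc, hcomm]
    have hpy : p k * y = y * p k := by
      rw [hy, ← mul_assoc, ← hqp, mul_assoc, mul_add, hpsum, mul_assoc, add_mul,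
        Algebra.commutes c₀ (p k)]
    have hor : M < ‖p k * y‖ ∨ M < ‖(1 - p k) * y‖ := by
      by_contra! h'
      exact h.not_ge (norm_le_of_norm_projection_mul_le (hp k) (hpp k) hpy h'.1 h'.2)
    rcases hor with h1 | h1
    · have e1 : p k * y = q * p k * (algebraMap ℂ A (c₀ + c k) + ∑ i ∈ s, c i • p i) := by
        rw [hy, ← mul_assoc, ← hqp, Finset.sum_insert hk, ← add_assoc, mul_add, mul_add, map_add]
        rw [mul_add, mul_add, mul_smul_comm, mul_assoc q (p k) (p k), hpp,
          Algebra.algebraMap_eq_smul_one (c k), mul_smul_comm, mul_one]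
      rw [e1] at h1
      obtain ⟨q', h0, hq', hor, hlt⟩ := ih (c₀ + c k) (q * p k)
        (by rw [star_mul, hp, hq, hqp])
        (by rw [mul_assoc, ← mul_assoc (p k), ← hqp, mul_assoc q, hpp, ← mul_assoc, hqq])
        (fun i => by rw [mul_assoc, hcomm, ← mul_assoc, hqp, mul_assoc]) h1
      have hk1 : q' * p k = q' := by
        rw [← hq', mul_assoc, mul_assoc, hpp]
      have hk2 : q' * q = q' := by
        calc q' * q = q' * (q * p k) * q := by rw [hq']
          _ = q' * (q * q * p k) := by rw [mul_assoc, mul_assoc, ← hqp, mul_assoc]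
          _ = q' := by rw [hqq, hq']
      refine ⟨q', h0, hk2, ?_, ?_⟩
      · intro i hi
        rcases Finset.mem_insert.mp hi with rfl | hi
        · exact Or.inl hk1
        · exact hor i hi
      · rwa [Finset.sum_insert hk, if_pos hk1, ← add_assoc]
    · have e0 : (1 - p k) * q = q * (1 - p k) := by rw [sub_mul, mul_sub, hqp]; simp
      have e2 : (1 - p k) * p k = 0 := by rw [sub_mul, hpp, one_mul, sub_self]
      have e1 : (1 - p k) * y = q * (1 - p k) * (algebraMap ℂ A c₀ + ∑ i ∈ s, c i • p i) := by
        rw [hy, ← mul_assoc, e0, Finset.sum_insert hk]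
        rw [mul_add, mul_add, mul_smul_comm, mul_assoc q _ (p k), e2, mul_zero, smul_zero, zero_add,
          mul_add]
      rw [e1] at h1
      obtain ⟨q', h0, hq', hor, hlt⟩ := ih c₀ (q * (1 - p k))
        (by rw [star_mul, star_sub, star_one, hp, hq, e0])
        (by rw [mul_assoc, ← mul_assoc (1 - p k), e0, mul_assoc q, mul_sub (1 - p k), e2, mul_one,
              sub_zero, ← mul_assoc, hqq])
        (fun i => by
          rw [mul_assoc, sub_mul, one_mul, hcomm, mul_sub, hqp, ← mul_assoc, hqp, ← mul_assoc,
            mul_sub, mul_one, mul_assoc]) h1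
      have hk1 : q' * p k = 0 := by
        rw [← hq', mul_assoc, mul_assoc, e2, mul_zero, mul_zero]
      have hk2 : q' * q = q' := by
        calc q' * q = q' * (q * (1 - p k)) * q := by rw [hq']
          _ = q' * (q * q * (1 - p k)) := by rw [mul_assoc, mul_assoc, e0, mul_assoc]
          _ = q' := by rw [hqq, hq']
      refine ⟨q', h0, hk2, ?_, ?_⟩
      · intro i hi
        rcases Finset.mem_insert.mp hi with rfl | hi
        · exact Or.inr hk1
        · exact hor i hi
      · rwa [Finset.sum_insert hk, if_neg (by rw [hk1]; exact h0.symm), zero_add]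

/-- An isometry has norm at most one. -/
theorem norm_le_one_of_star_mul_self {A : Type*} [CStarAlgebra A] {v : A} (hv : star v * v = 1) :
    ‖v‖ ≤ 1 := by
  have h1 : ‖(1 : A)‖ ≤ 1 := by
    have h := CStarRing.norm_star_mul_self (x := (1 : A))
    rw [star_one, mul_one] at h
    nlinarith [norm_nonneg (1 : A)]
  have h := CStarRing.norm_star_mul_self (x := v)
  rw [hv] at h
  nlinarith [norm_nonneg v]

namespace RingToeplitz

open scoped nonZeroDivisors

variable {R : Type*} [CommRing R] [IsDomain R]

namespace IsFamily

variable {A : Type*} [Ring A] [StarRing A] {u : R → A} {s : R⁰ → A} {e : NonzeroIdeal R → A}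
  (h : IsFamily u s e)

include h

/-- If a nonzero `q` lies below finitely many of the coset projections, then it lies below that of
a coset in the intersection. -/
theorem exists_coset_le {q : A} (hq : q ≠ 0) {ι : Type*} (S : Finset ι) (w : ι → R)
    (L : ι → NonzeroIdeal R) (hS : ∀ k ∈ S, q * cosetProj u e (w k) (L k) = q) {z : R}
    {I₀ : NonzeroIdeal R} (hz : q * cosetProj u e z I₀ = q) :
    ∃ x I, q * cosetProj u e x I = q ∧ x - z ∈ I₀.1 ∧ I.1 ≤ I₀.1 ∧
      ∀ k ∈ S, x - w k ∈ (L k).1 ∧ I.1 ≤ (L k).1 := by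
  classical
  induction S using Finset.induction_on with
  | empty => exact ⟨z, I₀, hz, by simp, le_rfl, by simp⟩
  | insert k S hk ih =>
    obtain ⟨x, I, h1, h2, h3, h4⟩ := ih fun j hj => hS j (Finset.mem_insert_of_mem hj)
    have h5 : q * (cosetProj u e x I * cosetProj u e (w k) (L k)) = q := by
      rw [← mul_assoc, h1, hS k (Finset.mem_insert_self _ _)]
    obtain ⟨y, hy1, hy2⟩ : ∃ y, y - x ∈ I.1 ∧ y - w k ∈ (L k).1 := by
      by_contra! hy
      rw [h.cosetProj_mul_of_disjoint hy, mul_zero] at h5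
      exact hq h5.symm
    rw [h.cosetProj_mul_of_mem hy1 hy2] at h5
    refine ⟨y, I.inter (L k), h5, ?_, inf_le_left.trans h3, fun j hj => ?_⟩
    · rw [← sub_add_sub_cancel y x z]
      exact I₀.1.add_mem (h3 hy1) h2
    · rcases Finset.mem_insert.mp hj with rfl | hj
      · exact ⟨hy2, inf_le_right⟩
      · refine ⟨?_, inf_le_left.trans (h4 j hj).2⟩
        rw [← sub_add_sub_cancel y x (w j)]
        exact (L j).1.add_mem ((h4 j hj).2 hy1) (h4 j hj).1

theorem not_coset_le {q : A} (hq : q ≠ 0) {x w : R} {I L : NonzeroIdeal R}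
    (hx : q * cosetProj u e x I = q) (hw : q * cosetProj u e w L = 0) :
    ¬ (x - w ∈ L.1 ∧ I.1 ≤ L.1) := by
  rintro ⟨h1, h2⟩
  have h3 : cosetProj u e w L * cosetProj u e x I = cosetProj u e x I := by
    rw [h.cosetProj_mul_of_mem h1 (by simp), NonzeroIdeal.inter_comm, NonzeroIdeal.inter_eq_left h2]
  apply hq
  rw [← hx, ← h3, ← mul_assoc, hw, zero_mul]

theorem cosetProj_mul_u_mul_s (z : R) (b : R⁰) :
    cosetProj u e z ((NonzeroIdeal.unit R).dilate b) * (u z * s b) = u z * s b := by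
  have h1 : u (-z) * u z = 1 := by rw [h.u_mul, neg_add_cancel, h.u_zero]
  calc u z * e ((NonzeroIdeal.unit R).dilate b) * u (-z) * (u z * s b)
      = u z * (e ((NonzeroIdeal.unit R).dilate b) * ((u (-z) * u z) * s b)) := by
        simp only [mul_assoc]
    _ = _ := by rw [h1, one_mul, ← h.s_mul_e, h.e_unit, mul_one]

end IsFamily

/-- In an infinite domain in which each nonzero element lies outside some nonzero maximal ideal,
each coset `x + I` contains a smaller one, not contained in any of finitely many cosets that do not
contain `x + I`, and on which finitely many affine functions do not vanish modulo its ideal. -/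
theorem exists_generic_coset [Infinite R]
    (hR : ∀ r : R, r ≠ 0 → ∃ P : Ideal R, P.IsMaximal ∧ P ≠ ⊥ ∧ r ∉ P)
    (x : R) (I : NonzeroIdeal R) {ι κ : Type*} (B : Finset ι) (w : ι → R) (L : ι → NonzeroIdeal R)
    (hB : ∀ k ∈ B, ¬ (x - w k ∈ (L k).1 ∧ I.1 ≤ (L k).1)) (E : Finset κ) (α β : κ → R)
    (hE : ∀ j ∈ E, α j ≠ 0 ∨ β j ≠ 0) :
    ∃ (y : R) (J : NonzeroIdeal R), y - x ∈ I.1 ∧ J.1 ≤ I.1 ∧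
      (∀ k ∈ B, ¬ (y - w k ∈ (L k).1 ∧ J.1 ≤ (L k).1)) ∧ ∀ j ∈ E, α j * y + β j ∉ J.1 := by
  classical
  obtain ⟨y, hyI, hyE⟩ : ∃ y, y - x ∈ I.1 ∧ ∀ j ∈ E, α j * y + β j ≠ 0 := by
    obtain ⟨m, hm, hm0⟩ := Submodule.exists_mem_ne_zero_of_ne_bot I.2
    have hfin : (⋃ j ∈ E, {r : R | α j * (x + m * r) + β j = 0}).Finite := by
      refine E.finite_toSet.biUnion fun j hj => Set.Subsingleton.finite fun r hr r' hr' => ?_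
      simp only [Set.mem_ofPred_eq] at hr hr'
      by_cases hα : α j = 0
      · rw [hα, zero_mul, zero_add] at hr
        exact absurd hr ((hE j hj).resolve_left (not_not.mpr hα))
      · refine mul_left_cancel₀ (mul_ne_zero hα hm0) ?_
        linear_combination hr - hr'
    obtain ⟨r, hr⟩ := hfin.infinite_compl.nonempty
    refine ⟨x + m * r, by simpa using I.1.mul_mem_right r hm, fun j hj h0 => hr ?_⟩
    exact Set.mem_biUnion (Finset.mem_coe.mpr hj) h0
  choose l hl hl0 using fun k => Submodule.exists_mem_ne_zero_of_ne_bot (L k).2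
  obtain ⟨P, hP, hP0, hrP⟩ := hR ((∏ k ∈ B, l k) * ∏ j ∈ E, (α j * y + β j))
    (mul_ne_zero (Finset.prod_ne_zero_iff.mpr fun k _ => hl0 k) (Finset.prod_ne_zero_iff.mpr hyE))
  refine ⟨y, ⟨I.1 * P, fun h0 => ?_⟩, hyI, Ideal.mul_le_left, fun k hk => ?_, fun j hj hj' => ?_⟩
  · rcases Ideal.mul_eq_bot.mp h0 with h1 | h1
    · exact I.2 h1
    · exact hP0 h1
  · rintro ⟨h1, h2⟩
    have hIL : I.1 ≤ (L k).1 := by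
      have hlP : l k ∉ P := fun hlP => hrP
        (P.mul_mem_right _ (P.mem_of_dvd (Finset.dvd_prod_of_mem l hk) hlP))
      have hsup : P ⊔ (L k).1 = ⊤ := by
        refine hP.out.2 _ (lt_of_le_of_ne le_sup_left fun h3 => hlP ?_)
        rw [h3]
        exact Ideal.mem_sup_right (hl k)
      calc I.1 = I.1 * (P ⊔ (L k).1) := by rw [hsup, Ideal.mul_top]
        _ = I.1 * P ⊔ I.1 * (L k).1 := Ideal.mul_sup _ _ _
        _ ≤ (L k).1 := sup_le h2 Ideal.mul_le_right
    refine hB k hk ⟨?_, hIL⟩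
    have h3 := (L k).1.sub_mem h1 (hIL hyI)
    rwa [sub_sub_sub_cancel_left] at h3
  · exact hrP (P.mul_mem_left _ (P.mem_of_dvd
      (Finset.dvd_prod_of_mem (fun j => α j * y + β j) hj) (Ideal.mul_le_right hj')))

open Classical in
theorem cosetProj_opU_opE_mk (w : R) (L J : NonzeroIdeal R) (y : R) :
    cosetProj opU opE w L (basisVector J (Ideal.Quotient.mk J.1 y)) =
      if y - w ∈ L.1 ∧ J.1 ≤ L.1 then basisVector J (Ideal.Quotient.mk J.1 y) else 0 := by
  rw [cosetProj, mul_apply_eq_comp, mul_apply_eq_comp, opU_mk, opE_mk, neg_add_eq_sub]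
  simp only [and_comm]
  split_ifs
  · rw [opU_mk, add_sub_cancel]
  · rw [map_zero]

theorem inner_basisVector_eq_zero {I J : NonzeroIdeal R} {x y : R}
    (h : ¬ (I = J ∧ x - y ∈ I.1)) :
    inner ℂ (basisVector I (Ideal.Quotient.mk I.1 x)) (basisVector J (Ideal.Quotient.mk J.1 y)) =
      0 := by
  refine orthonormal_basisVector.2 (i := ⟨I, Ideal.Quotient.mk I.1 x⟩)
    (j := ⟨J, Ideal.Quotient.mk J.1 y⟩) fun h' => h ?_
  obtain ⟨rfl, h2⟩ := Sigma.mk.inj_iff.mp h'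
  exact ⟨rfl, Ideal.Quotient.eq.mp (eq_of_heq h2)⟩

theorem MonomialIndex.degree_eq_iff {i j : MonomialIndex R} {c d : R⁰}
    (h : c * i.a = d * j.a) :
    i.degree = j.degree ↔ c * (i.x + i.y) = d * (j.x + j.y) ∧ c * i.b = d * j.b := by
  have key (i : MonomialIndex R) (c : R⁰) :
      (fractionUnit (c * i.a) : FractionRing R) * i.degree.1 =
        algebraMap R (FractionRing R) (c * (i.x + i.y)) ∧
      fractionUnit (c * i.a) * i.degree.2 = fractionUnit (c * i.b) := by
    constructor
    · rw [map_mul, map_mul, coe_fractionUnit c |>.symm, MonomialIndex.degree]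
      simp [mul_assoc]
    · simp [MonomialIndex.degree, mul_assoc]
  obtain ⟨hi1, hi2⟩ := key i c
  obtain ⟨hj1, hj2⟩ := key j d
  rw [h] at hi1 hi2
  constructor
  · intro hij
    rw [hij] at hi1 hi2
    exact ⟨IsFractionRing.injective R (FractionRing R) (hi1.symm.trans hj1),
      fractionUnit_injective (hi2.symm.trans hj2)⟩
  · rintro ⟨h1, h2⟩
    rw [h1, ← hj1] at hi1
    rw [h2, ← hj2] at hi2
    exact Prod.ext ((Units.mul_right_inj _).mp hi1) (mul_left_cancel hi2)

end RingToeplitz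

/-! ### The homogeneous components are controlled by the natural representation -/

namespace RingToeplitz

open scoped nonZeroDivisors

variable {R : Type*} [CommRing R] [IsDomain R]

namespace Toeplitz

theorem naturalRep_u (x : R) : naturalRep R (u x) = opU x := lift_u isFamily_op x

theorem naturalRep_s (a : R⁰) : naturalRep R (s a) = opS a := lift_s isFamily_op a

theorem naturalRep_e (I : NonzeroIdeal R) : naturalRep R (e I) = opE I := lift_e isFamily_op I

theorem norm_naturalRep_le (t : Toeplitz R) : ‖naturalRep R t‖ ≤ ‖t‖ :=
  NonUnitalStarAlgHom.norm_apply_le (naturalRep R) t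

theorem naturalRep_cosetProj (w : R) (L : NonzeroIdeal R) :
    naturalRep R (cosetProj u e w L) = cosetProj opU opE w L := by
  simp only [cosetProj, map_mul, naturalRep_u, naturalRep_e]

theorem norm_u_mul_s_le (x : R) (a : R⁰) : ‖(u x * s a : Toeplitz R)‖ ≤ 1 := by
  apply norm_le_one_of_star_mul_self
  rw [star_mul, mul_assoc, ← mul_assoc (star (u x)), isFamily _ _ (.u_star_mul_self x), one_mul,
    isFamily.star_s_mul_s]

theorem norm_s_le (a : R⁰) : ‖(s a : Toeplitz R)‖ ≤ 1 :=
  norm_le_one_of_star_mul_self (isFamily.star_s_mul_s a)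

open Classical in
/-- The matrix coefficients of a linear combination of elements `cosetProj w L * u z * s b` at a
generic basis vector only see the terms with a given `z` and `b`. -/
theorem norm_sum_ite_le {ι : Type*} (S : Finset ι) (c : ι → ℂ) (w : ι → R)
    (L : ι → NonzeroIdeal R) (z : ι → R) (b : ι → R⁰) (z₀ : R) (b₀ : R⁰) {y : R}
    {J : NonzeroIdeal R} (hy : y - z₀ ∈ ((NonzeroIdeal.unit R).dilate b₀).1)
    (hJ : J.1 ≤ ((NonzeroIdeal.unit R).dilate b₀).1)
    (hgen : ∀ i ∈ S, ¬ (z i = z₀ ∧ b i = b₀) → (b i - b₀ : R) * y + (b₀ * z i - b i * z₀) ∉ J.1) :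
    ‖∑ i ∈ S.filter fun i => z i = z₀ ∧ b i = b₀,
        if y - w i ∈ (L i).1 ∧ J.1 ≤ (L i).1 then c i else 0‖ ≤
      ‖naturalRep R (∑ i ∈ S, c i • (cosetProj u e (w i) (L i) * (u (z i) * s (b i))))‖ := by
  obtain ⟨J', rfl⟩ := NonzeroIdeal.exists_dilate_of_le hJ
  obtain ⟨v, hv⟩ := NonzeroIdeal.mem_dilate_unit.mp hy
  obtain rfl : y = z₀ + b₀ * v := by rw [← hv]; ring
  set y := z₀ + b₀ * v with hy_def
  set J := J'.dilate b₀ with hJ_def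
  set η := basisVector J (Ideal.Quotient.mk J.1 y) with hη
  set ξ := basisVector J' (Ideal.Quotient.mk J'.1 v) with hξ
  have hη1 : ‖η‖ = 1 := orthonormal_basisVector.1 ⟨J, Ideal.Quotient.mk J.1 y⟩
  have hξ1 : ‖ξ‖ = 1 := orthonormal_basisVector.1 ⟨J', Ideal.Quotient.mk J'.1 v⟩
  have hcoef (i : ι) (hi : i ∈ S) :
      inner ℂ η ((cosetProj opU opE (w i) (L i) * (opU (z i) * opS (b i))) ξ) =
        if (z i = z₀ ∧ b i = b₀) ∧ (y - w i ∈ (L i).1 ∧ J.1 ≤ (L i).1) then (1 : ℂ) else 0 := by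
    have hP : inner ℂ η ((cosetProj opU opE (w i) (L i) * (opU (z i) * opS (b i))) ξ) =
        inner ℂ (cosetProj opU opE (w i) (L i) η)
          (basisVector (J'.dilate (b i))
            (Ideal.Quotient.mk (J'.dilate (b i)).1 (z i + b i * v))) := by
      rw [mul_apply_eq_comp, mul_apply_eq_comp, hξ, opS_mk, opU_mk]
      nth_rewrite 1 [← isFamily_op.star_cosetProj]
      rw [ContinuousLinearMap.star_eq_adjoint, ContinuousLinearMap.adjoint_inner_right]
    rw [hP, hη, cosetProj_opU_opE_mk]
    by_cases h1 : y - w i ∈ (L i).1 ∧ J.1 ≤ (L i).1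
    · rw [if_pos h1]
      by_cases h2 : z i = z₀ ∧ b i = b₀
      · rw [if_pos ⟨h2, h1⟩, basisVector_congr (I := J'.dilate (b i)) (J := J)
          (x := z i + b i * v) (y := y) (by rw [h2.2]) (by rw [h2.1, h2.2]), ← hη,
          inner_self_eq_norm_sq_to_K, hη1]
        simp
      · rw [if_neg fun h3 => h2 h3.1]
        refine inner_basisVector_eq_zero fun h3 => hgen i hi h2 ?_
        have h4 := J.1.neg_mem (J.1.mul_mem_left (b₀ : R) h3.2)
        have h5 : (b i - b₀ : R) * y + (b₀ * z i - b i * z₀) =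
            -((b₀ : R) * (y - (z i + b i * v))) := by rw [hy_def]; ring
        rwa [h5]
    · rw [if_neg h1, inner_zero_left, if_neg fun h3 => h1 h3.2]
  have hsum : inner ℂ η
      (naturalRep R (∑ i ∈ S, c i • (cosetProj u e (w i) (L i) * (u (z i) * s (b i)))) ξ) =
      ∑ i ∈ S.filter fun i => z i = z₀ ∧ b i = b₀,
        if y - w i ∈ (L i).1 ∧ J.1 ≤ (L i).1 then c i else 0 := by
    simp only [map_sum, map_smul, map_mul, naturalRep_cosetProj, naturalRep_u, naturalRep_s]
    rw [sum_apply, inner_sum, Finset.sum_filter]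
    refine Finset.sum_congr rfl fun i hi => ?_
    rw [smul_apply, inner_smul_right, hcoef i hi, mul_ite, mul_one, mul_zero, ite_and]
  rw [← hsum]
  refine (norm_inner_le_norm _ _).trans ?_
  rw [hη1, one_mul]
  refine (ContinuousLinearMap.le_opNorm _ _).trans ?_
  rw [hξ1, mul_one]

open Classical in
/-- The norm of a homogeneous component of a linear combination of monomials is at most the norm of
the operator by which the linear combination acts. -/
theorem norm_sum_filter_degree_le [Infinite R]
    (hR : ∀ r : R, r ≠ 0 → ∃ P : Ideal R, P.IsMaximal ∧ P ≠ ⊥ ∧ r ∉ P)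
    (c : MonomialIndex R →₀ ℂ) (g : FractionRing R × (FractionRing R)ˣ) :
    ‖∑ i ∈ c.support.filter fun i => i.degree = g, c i • monomial u s e i‖ ≤
      ‖naturalRep R (ofMonomials R c)‖ := by
  by_contra! hlt
  obtain ⟨i₀, hi₀⟩ : (c.support.filter fun i => i.degree = g).Nonempty := by
    rw [Finset.nonempty_iff_ne_empty]
    intro h0
    rw [h0, Finset.sum_empty, norm_zero] at hlt
    exact absurd hlt (norm_nonneg _).not_gt
  obtain ⟨hmem, rfl⟩ := Finset.mem_filter.mp hi₀
  set a : R⁰ := ∏ i ∈ c.support, i.a with ha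
  have hcof (i : MonomialIndex R) : ∃ k : R⁰, i ∈ c.support → k * i.a = a := by
    by_cases hi : i ∈ c.support
    · obtain ⟨k, hk⟩ := Finset.dvd_prod_of_mem (fun i : MonomialIndex R => i.a) hi
      exact ⟨k, fun _ => by rw [ha, hk, mul_comm]⟩
    · exact ⟨1, fun h => absurd h hi⟩
  choose k hk using hcof
  have hform (i : MonomialIndex R) : ∃ (ε : ℂ) (w : R) (L : NonzeroIdeal R),
      s (k i * i.a) * monomial u s e i =
        ε • (cosetProj u e w L * (u (k i * (i.x + i.y)) * s (k i * i.b)) : Toeplitz R) := by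
    rcases isFamily.s_mul_monomial_eq (k i) i with h | ⟨w, L, h⟩
    · exact ⟨0, 0, NonzeroIdeal.unit R, by rw [h, zero_smul]⟩
    · exact ⟨1, w, L, by rw [h, one_smul]⟩
  choose ε w L hform using hform
  set z : MonomialIndex R → R := fun i => k i * (i.x + i.y) with hz
  set b : MonomialIndex R → R⁰ := fun i => k i * i.b with hb
  have hdeg (i : MonomialIndex R) (hi : i ∈ c.support) :
      i.degree = i₀.degree ↔ z i = z i₀ ∧ b i = b i₀ :=
    MonomialIndex.degree_eq_iff ((hk i hi).trans (hk i₀ hmem).symm)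
  have hfilter : (c.support.filter fun i => i.degree = i₀.degree) =
      c.support.filter fun i => z i = z i₀ ∧ b i = b i₀ :=
    Finset.filter_congr fun i hi => hdeg i hi
  have hs (S : Finset (MonomialIndex R)) (hS : S ⊆ c.support) :
      s a * ∑ i ∈ S, c i • monomial u s e i =
        ∑ i ∈ S, (c i * ε i) • (cosetProj u e (w i) (L i) * (u (z i) * s (b i))) := by
    rw [Finset.mul_sum]
    refine Finset.sum_congr rfl fun i hi => ?_
    rw [mul_smul_comm, ← hk i (hS hi), hform, smul_smul]
  rw [hfilter] at hlt
  set S := c.support.filter fun i => z i = z i₀ ∧ b i = b i₀ with hS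
  set q : Toeplitz R := cosetProj u e (z i₀) ((NonzeroIdeal.unit R).dilate (b i₀)) with hq
  set M := ‖naturalRep R (ofMonomials R c)‖ with hM
  have hbig : M < ‖q * (algebraMap ℂ (Toeplitz R) 0 +
      ∑ i ∈ S, (c i * ε i) • cosetProj u e (w i) (L i))‖ := by
    refine hlt.trans_le ?_
    set t := ∑ i ∈ S, c i • monomial u s e i with ht
    set d : Toeplitz R := ∑ i ∈ S, (c i * ε i) • cosetProj u e (w i) (L i) with hd
    have h1 : s a * t = q * d * (u (z i₀) * s (b i₀)) := by
      rw [hs S (Finset.filter_subset _ _)]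
      have h2 : q * d = d * q := by
        rw [hd, Finset.mul_sum, Finset.sum_mul]
        refine Finset.sum_congr rfl fun i _ => ?_
        rw [mul_smul_comm, smul_mul_assoc, isFamily.cosetProj_commute]
      rw [h2, mul_assoc, isFamily.cosetProj_mul_u_mul_s, hd, Finset.sum_mul]
      refine Finset.sum_congr rfl fun i hi => ?_
      obtain ⟨h3, h4⟩ := (Finset.mem_filter.mp hi).2
      rw [h3, h4, smul_mul_assoc]
    have h2 : t = star (s a) * (s a * t) := by
      rw [← mul_assoc, isFamily.star_s_mul_s, one_mul]
    rw [map_zero, zero_add]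
    calc ‖t‖ = ‖star (s a) * (s a * t)‖ := by rw [← h2]
      _ ≤ 1 * ‖s a * t‖ := (norm_mul_le _ _).trans
          (mul_le_mul_of_nonneg_right (by rw [norm_star]; exact norm_s_le a) (norm_nonneg _))
      _ ≤ ‖q * d‖ * 1 := by
          rw [one_mul, h1]
          exact (norm_mul_le _ _).trans
            (mul_le_mul_of_nonneg_left (norm_u_mul_s_le _ _) (norm_nonneg _))
      _ = ‖q * d‖ := mul_one _
  obtain ⟨q', hq0, hqq, hor, hqM⟩ := exists_mul_projection_eq S
    (fun i => (cosetProj u e (w i) (L i) : Toeplitz R)) (fun i => isFamily.star_cosetProj _ _)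
    (fun i => isFamily.cosetProj_mul_self _ _) (fun i j => isFamily.cosetProj_commute _ _ _ _)
    (fun i => c i * ε i) (norm_nonneg _) 0 q (isFamily.star_cosetProj _ _)
    (isFamily.cosetProj_mul_self _ _) (fun i => isFamily.cosetProj_commute _ _ _ _) hbig
  obtain ⟨x, I, hxI, hxz, hIz, hxS⟩ := isFamily.exists_coset_le hq0
    (S.filter fun i => q' * cosetProj u e (w i) (L i) = q') w L
    (fun i hi => (Finset.mem_filter.mp hi).2) hqq
  obtain ⟨y, J, hyx, hJI, hyB, hyE⟩ := exists_generic_coset hR x I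
    (S.filter fun i => q' * cosetProj u e (w i) (L i) = 0) w L
    (fun i hi => isFamily.not_coset_le hq0 hxI (Finset.mem_filter.mp hi).2)
    (c.support.filter fun i => ¬ (z i = z i₀ ∧ b i = b i₀)) (fun i => (b i - b i₀ : R))
    (fun i => b i₀ * z i - b i * z i₀) (fun i hi => by
      have h1 := (Finset.mem_filter.mp hi).2
      by_contra! h2
      have h3 : b i = b i₀ := Subtype.ext (sub_eq_zero.mp h2.1)
      refine h1 ⟨?_, h3⟩
      have h4 := h2.2
      rw [h3, sub_eq_zero] at h4
      exact mul_left_cancel₀ (nonZeroDivisors.coe_ne_zero (b i₀)) h4)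
  have hyz : y - z i₀ ∈ ((NonzeroIdeal.unit R).dilate (b i₀)).1 := by
    rw [← sub_add_sub_cancel y x]
    exact Ideal.add_mem _ (hIz hyx) hxz
  have hfin := norm_sum_ite_le c.support (fun i => c i * ε i) w L z b (z i₀) (b i₀) hyz
    (hJI.trans hIz) fun i hi hi' => hyE i (Finset.mem_filter.mpr ⟨hi, hi'⟩)
  rw [← hs c.support subset_rfl, ← ofMonomials_apply, map_mul] at hfin
  have hle : ‖naturalRep R (s a) * naturalRep R (ofMonomials R c)‖ ≤ M :=
    (norm_mul_le _ _).trans (mul_le_of_le_one_left (norm_nonneg _)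
      ((norm_naturalRep_le _).trans (norm_s_le a)))
  have heq : ∀ i ∈ S, (if y - w i ∈ (L i).1 ∧ J.1 ≤ (L i).1 then c i * ε i else 0) =
      if q' * cosetProj u e (w i) (L i) = q' then c i * ε i else 0 := by
    intro i hi
    by_cases h1 : q' * cosetProj u e (w i) (L i) = q'
    · obtain ⟨h2, h3⟩ := hxS i (Finset.mem_filter.mpr ⟨hi, h1⟩)
      have h4 : y - w i ∈ (L i).1 := by
        rw [← sub_add_sub_cancel y x]
        exact Ideal.add_mem _ (h3 hyx) h2
      rw [if_pos h1, if_pos ⟨h4, hJI.trans h3⟩]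
    · rw [if_neg h1, if_neg (hyB i (Finset.mem_filter.mpr ⟨hi, (hor i hi).resolve_left h1⟩))]
  rw [zero_add, ← Finset.sum_congr rfl heq] at hqM
  exact (hfin.trans hle).not_gt hqM

end Toeplitz

end RingToeplitz

/-! ### Faithfulness -/

namespace RingToeplitz

variable {R : Type*} [CommRing R] [IsDomain R]

namespace Toeplitz

open Classical in
/-- The multiplier `overlap F` is a combination of the projections to the homogeneous components. -/
theorem norm_sum_overlap_smul_le_naturalRep [Infinite R]
    (hR : ∀ r : R, r ≠ 0 → ∃ P : Ideal R, P.IsMaximal ∧ P ≠ ⊥ ∧ r ∉ P)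
    (F : Finset (FractionRing R × (FractionRing R)ˣ)) (c : MonomialIndex R →₀ ℂ) :
    ‖∑ i ∈ c.support, (overlap F i.degree : ℂ) • c i • monomial u s e i‖ ≤
      (finite_overlap_ne_zero F).toFinset.card * ‖naturalRep R (ofMonomials R c)‖ := by
  set N := (finite_overlap_ne_zero F).toFinset with hN
  have h1 : ∑ i ∈ c.support, (overlap F i.degree : ℂ) • c i • (monomial u s e i : Toeplitz R) =
      ∑ g ∈ N, (overlap F g : ℂ) •
        ∑ i ∈ c.support.filter fun i => i.degree = g, c i • (monomial u s e i : Toeplitz R) := by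
    simp only [Finset.smul_sum, Finset.sum_filter]
    rw [Finset.sum_comm]
    refine Finset.sum_congr rfl fun i _ => ?_
    simp only [smul_ite, smul_zero]
    rw [Finset.sum_ite_eq]
    split_ifs with h
    · rfl
    · rw [hN, Set.Finite.mem_toFinset, Set.mem_ofPred_eq, not_not] at h
      rw [h, Complex.ofReal_zero, zero_smul]
  rw [h1, ← nsmul_eq_mul]
  refine (norm_sum_le _ _).trans (Finset.sum_le_card_nsmul _ _ _ fun g _ => ?_)
  rw [norm_smul, Complex.norm_real, Real.norm_of_nonneg (overlap_nonneg F g)]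
  exact (mul_le_of_le_one_left (norm_nonneg _) (overlap_le_one F g)).trans
    (norm_sum_filter_degree_le hR c g)

open Classical in
/-- The multipliers `overlap F` approximate the identity. -/
theorem exists_norm_sub_sum_overlap_smul_le (c : MonomialIndex R →₀ ℂ) {ε : ℝ} (hε : 0 < ε) :
    ∃ F : Finset (FractionRing R × (FractionRing R)ˣ), F.Nonempty ∧
      ‖ofMonomials R c - ∑ i ∈ c.support, (overlap F i.degree : ℂ) • c i • monomial u s e i‖ ≤
        ε := by
  set C := ∑ i ∈ c.support, ‖c i • (monomial u s e i : Toeplitz R)‖ with hC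
  have hC0 : 0 ≤ C := Finset.sum_nonneg fun i _ => norm_nonneg _
  obtain ⟨F, hF, hFS⟩ := exists_finset_card_filter_affineShift_mem_ge
    (c.support.image MonomialIndex.degree) (ε := ε / (C + 1)) (by positivity)
  refine ⟨F, hF, ?_⟩
  have hn : (0 : ℝ) < F.card := by exact_mod_cast hF.card_pos
  have h1 (i : MonomialIndex R) (hi : i ∈ c.support) : 1 - overlap F i.degree ≤ ε / (C + 1) := by
    have h2 : 1 - ε / (C + 1) ≤ overlap F i.degree := by
      rw [overlap, le_div_iff₀ hn]
      refine (hFS _ (Finset.mem_image_of_mem _ hi)).trans_eq ?_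
      congr!
    linarith
  rw [ofMonomials_apply, ← Finset.sum_sub_distrib]
  have h3 : ∀ i ∈ c.support, ‖c i • (monomial u s e i : Toeplitz R) -
      (overlap F i.degree : ℂ) • c i • monomial u s e i‖ ≤
      ε / (C + 1) * ‖c i • (monomial u s e i : Toeplitz R)‖ := by
    intro i hi
    have h4 : c i • (monomial u s e i : Toeplitz R) -
        (overlap F i.degree : ℂ) • c i • monomial u s e i =
        ((1 - overlap F i.degree : ℝ) : ℂ) • c i • monomial u s e i := by
      rw [Complex.ofReal_sub, Complex.ofReal_one, sub_smul, one_smul]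
    rw [h4, norm_smul, Complex.norm_real,
      Real.norm_of_nonneg (sub_nonneg.mpr (overlap_le_one F _))]
    exact mul_le_mul_of_nonneg_right (h1 i hi) (norm_nonneg _)
  refine (norm_sum_le_of_le _ h3).trans ?_
  rw [← Finset.mul_sum, ← hC, div_mul_eq_mul_div, div_le_iff₀ (by positivity)]
  nlinarith

/-- The natural representation is faithful for each infinite domain in which no nonzero element
lies in all nonzero maximal ideals. -/
theorem naturalRep_injective [Infinite R]
    (hR : ∀ r : R, r ≠ 0 → ∃ P : Ideal R, P.IsMaximal ∧ P ≠ ⊥ ∧ r ∉ P) :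
    Function.Injective (naturalRep R) := by
  refine (injective_iff_map_eq_zero (naturalRep R)).mpr fun t ht => ?_
  have happrox (ε : ℝ) (hε : 0 < ε) : ∃ c, ‖t - ofMonomials R c‖ < ε := by
    obtain ⟨c, hc⟩ := denseRange_ofMonomials.exists_dist_lt t hε
    exact ⟨c, by rwa [← dist_eq_norm]⟩
  have hsub (F : Finset (FractionRing R × (FractionRing R)ˣ)) (c : MonomialIndex R →₀ ℂ) :
      ∑ i ∈ c.support, (overlap F i.degree : ℂ) • c i • (monomial u s e i : Toeplitz R) =
        Finsupp.linearCombination ℂ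
          (fun i : MonomialIndex R => (overlap F i.degree : ℂ) • monomial u s e i) c := by
    rw [Finsupp.linearCombination_apply, Finsupp.sum]
    exact Finset.sum_congr rfl fun i _ => smul_comm _ _ _
  rw [← norm_eq_zero]
  refine le_antisymm (le_of_forall_pos_le_add fun δ hδ => ?_) (norm_nonneg t)
  have hε : 0 < δ / 5 := by positivity
  set ε := δ / 5 with hεδ
  obtain ⟨c, hc⟩ := happrox ε hε
  obtain ⟨F, hF, hcF⟩ := exists_norm_sub_sum_overlap_smul_le c hε
  set n : ℕ := (finite_overlap_ne_zero F).toFinset.card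
  have hn0 : (0 : ℝ) ≤ n := Nat.cast_nonneg _
  obtain ⟨d, hd⟩ := happrox (min ε (ε / (n + 1))) (lt_min hε (by positivity))
  have hd1 := hd.le.trans (min_le_left _ _)
  have hd2 := hd.le.trans (min_le_right _ _)
  have h1 := norm_sum_overlap_smul_le_naturalRep hR F d
  have h2 : ‖naturalRep R (ofMonomials R d)‖ ≤ ε / (n + 1) := by
    have h := norm_naturalRep_le (t - ofMonomials R d)
    rw [map_sub, ht, zero_sub, norm_neg] at h
    exact h.trans hd2
  have h3 : n * ‖naturalRep R (ofMonomials R d)‖ ≤ ε := by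
    refine (mul_le_mul_of_nonneg_left h2 hn0).trans ?_
    rw [mul_div_assoc', div_le_iff₀ (by positivity)]
    nlinarith
  have h4 := norm_sum_overlap_smul_le F hF (c - d)
  rw [hsub, map_sub, map_sub, ← hsub, ← hsub] at h4
  have h5 : ‖ofMonomials R c - ofMonomials R d‖ ≤ 2 * ε := by
    have h6 : ofMonomials R c - ofMonomials R d =
        (t - ofMonomials R d) - (t - ofMonomials R c) := by abel
    rw [h6]
    refine (norm_sub_le _ _).trans ?_
    linarith
  set x := ofMonomials R c
  set Φc := ∑ i ∈ c.support, (overlap F i.degree : ℂ) • c i • (monomial u s e i : Toeplitz R)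
  set Φd := ∑ i ∈ d.support, (overlap F i.degree : ℂ) • d i • (monomial u s e i : Toeplitz R)
  have h7 : t = (t - x) + (x - Φc) + (Φc - Φd) + Φd := by abel
  have h8 : ‖t‖ ≤ ‖t - x‖ + ‖x - Φc‖ + ‖Φc - Φd‖ + ‖Φd‖ := by
    nth_rewrite 1 [h7]
    exact norm_add₄_le
  linarith

end Toeplitz

open NumberField in
/-- In a ring of integers, each nonzero element lies outside some nonzero maximal ideal. -/
theorem exists_isMaximal_notMem (K : Type*) [Field K] [NumberField K] (r : 𝓞 K) (hr : r ≠ 0) :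
    ∃ P : Ideal (𝓞 K), P.IsMaximal ∧ P ≠ ⊥ ∧ r ∉ P := by
  set n := Ideal.absNorm (Ideal.span {r}) with hn
  have hn0 : n ≠ 0 := by
    rw [hn, Ne, Ideal.absNorm_eq_zero_iff, Ideal.span_singleton_eq_bot]
    exact hr
  have hrn : r ∣ (n : 𝓞 K) := Ideal.mem_span_singleton.mp (Ideal.absNorm_mem _)
  have hunit : ¬ IsUnit ((n + 1 : ℕ) : 𝓞 K) := by
    intro h
    have h1 := h.map (Algebra.norm ℤ)
    rw [← Int.cast_natCast, ← eq_intCast (algebraMap ℤ (𝓞 K)), Algebra.norm_algebraMap,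
      isUnit_pow_iff Module.finrank_pos.ne', Int.isUnit_iff] at h1
    omega
  obtain ⟨P, hP, hmem⟩ := exists_max_ideal_of_mem_nonunits hunit
  refine ⟨P, hP, ?_, fun hrP => ?_⟩
  · rintro rfl
    have : ((n + 1 : ℕ) : 𝓞 K) = 0 := hmem
    exact absurd (Nat.cast_eq_zero.mp this) n.succ_ne_zero
  · refine hP.ne_top ((Ideal.eq_top_iff_one P).mpr ?_)
    have h1 := P.sub_mem hmem (P.mem_of_dvd hrn hrP)
    simpa using h1

end RingToeplitz

/-- For the ring of integers `R = 𝓞 K` of a number field, the natural representation `μ` of the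
Toeplitz algebra of `R` on `⨁ I, ℓ²(R/I)` is faithful (injective); it is isometric, its image is
closed, and it is a `*`-isomorphism onto its image. -/
theorem corollary4p14 (K : Type*) [Field K] [NumberField K] :
    Function.Injective (RingToeplitz.naturalRep (NumberField.RingOfIntegers K)) ∧
    Isometry (RingToeplitz.naturalRep (NumberField.RingOfIntegers K)) ∧
    IsClosed (Set.range (RingToeplitz.naturalRep (NumberField.RingOfIntegers K))) ∧
    ∃ Φ : RingToeplitz.Toeplitz (NumberField.RingOfIntegers K) ≃⋆ₐ[ℂ]
        (RingToeplitz.naturalRep (NumberField.RingOfIntegers K)).range,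
      ∀ t : RingToeplitz.Toeplitz (NumberField.RingOfIntegers K),
        ((Φ t : (RingToeplitz.naturalRep (NumberField.RingOfIntegers K)).range) :
          RingToeplitz.HilbertSum (NumberField.RingOfIntegers K) →L[ℂ]
            RingToeplitz.HilbertSum (NumberField.RingOfIntegers K)) =
          RingToeplitz.naturalRep (NumberField.RingOfIntegers K) t := by
  have hinj := RingToeplitz.Toeplitz.naturalRep_injective
    (RingToeplitz.exists_isMaximal_notMem K)
  have hiso : Isometry (RingToeplitz.naturalRep (NumberField.RingOfIntegers K)) :=
    NonUnitalStarAlgHom.isometry _ hinj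
  exact ⟨hinj, hiso, hiso.isClosedEmbedding.isClosed_range, StarAlgEquiv.ofInjective _ hinj,
    fun t => rfl⟩
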